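/- **Theorem 4.3.** Let $S$ be a compact connected oriented surface with non-empty boundary and $M\subset\partial S$ a finite set of marked points meeting every boundary component. Let $T$ be a triangulation of $(S,M)$, that is, a collection of arcs (with endpoints in $M$ and relative interiors pairwise disjoint and disjoint from $M\cup\partial S$) that cuts $S$ into triangles with vertex set $M$. The quiver $Q_T$ has the arcs of $T$ as vertices and one arrow $i\to j$ for each triangle in which the sides $i,j$ are arcs and $j$ follows $i$ counterclockwise. An *internal* triangle is one all of whose sides are arcs. For a field $k$ let $\Lambda_T=kQ_T/I_T$, where $I_T$ is generated by the paths of length two in the $3$-cycles given by the internal triangles. An *admissible cut* $\chi$ selects a corner in each internal triangle, equivalently the arrow at that corner between the two sides meeting there. It defines a grading on $\Lambda_T$ in which the selected arrows have degree $1$ and all other arrows degree $0$; write $\tilde\Lambda$ for $\Lambda_T$ with this grading. Let $\chi_1,\chi_2$ be admissible cuts of $T$, with graded algebras $\tilde\Lambda_1,\tilde\Lambda_2$, and suppose that these are *graded equivalent*: there are integers $r_i$ (one for each vertex $i$ of $Q_T$) and an isomorphism of graded algebras $$\tilde\Lambda_2\;\cong\;\bigoplus_{p\in\mathbb Z}\operatorname{Hom}_{\operatorname{gr}\tilde\Lambda_1}\Bigl(\bigoplus_i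 P_i\langle r_i\rangle,\ \bigoplus_i P_i\langle r_i+p\rangle\Bigr),$$ where $P_i=e_i\tilde\Lambda_1$ and $(P\langle q\rangle)^d=P^{d+q}$. As an ungraded algebra the right-hand side is $\operatorname{End}_{\Lambda_T}(\Lambda_T)=\Lambda_T$, so the inverse isomorphism is an algebra isomorphism $f\colon\tilde\Lambda_1\to\tilde\Lambda_2$. Suppose that $f$ induces an automorphism $\varphi$ of the quiver $Q_T$, i.e. $f(e_i)\equiv e_{\varphi(i)}$ modulo the arrow ideal and, for each arrow $\alpha$, $f(\alpha)\equiv c_\alpha\varphi(\alpha)$ modulo the square of the arrow ideal with $c_\alpha\in k^\times$. Let $MG(S,M)=\mathrm{Homeo}^+(S,M)/\mathrm{Homeo}_0(S,M)$, where $\mathrm{Homeo}^+(S,M)$ is the group of orientation-preserving homeomorphisms of $S$ mapping $M$ to $M$ and $\mathrm{Homeo}_0(S,M)$ is the subgroup of those isotopic to the identity by an isotopy fixing $M$ pointwise. Then there is a mapping class $f_S\in MG(S,M)$ that induces the same automorphism $\varphi$: it has a representative $h$ with $h(\tau_i)=\tau_{\varphi(i)}$ for every arc $\tau_i$ of $T$,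 and mapping the triangle of each arrow $\alpha$ onto the triangle of $\varphi(\alpha)$. Moreover, if $f(\chi_1)$ denotes the admissible cut whose set of arrows is the image under $\varphi$ of the set of arrows of $\chi_1$, then $(f(\chi_1),\chi_2)$ is *equi-distributed*: for every boundary component $B$ of $S$, the number of internal triangles in which $f(\chi_1)$ selects a corner lying on $B$ equals the number of those in which $\chi_2$ does. -/

import Mathlib

open scoped Manifold Topology Complex.UnitDisc unitInterval

/-! ### Orientations of topological surfaces -/

/-- An open embedding `g` of the open unit disc into itself preserves orientation: as `z` runs once
counterclockwise around a circle about `0`, the point `g z` winds exactly once counterclockwise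
around `g 0`; the function `θ` is a continuous choice of the argument of `g z - g 0`. -/
def DiscOrientationPreserving (g : 𝔻 → 𝔻) : Prop :=
  ∀ z : 𝔻, z ≠ 0 → ∃ θ : ℝ → ℝ, Continuous θ ∧
    (∀ t : ℝ, (g (Circle.exp t • z) : ℂ) - (g 0 : ℂ) =
      (‖(g (Circle.exp t • z) : ℂ) - (g 0 : ℂ)‖ : ℂ) * (Circle.exp (θ t) : ℂ)) ∧
    θ (2 * Real.pi) = θ 0 + 2 * Real.pi

/-- An orientation of a topological surface `S`, given by its positively oriented discs: a set of
open embeddings of the open unit disc into `S` which, for each open embedding, contains it or its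
mirror image, and in which a subdisc of a positive disc is positive exactly when it sits in it in
an orientation-preserving way. -/
structure SurfaceOrientation (S : Type*) [TopologicalSpace S] where
  pos : Set (𝔻 → S)
  isOpenEmbedding : ∀ ψ ∈ pos, Topology.IsOpenEmbedding ψ
  pos_or_mirror : ∀ ψ : 𝔻 → S, Topology.IsOpenEmbedding ψ → ψ ∈ pos ∨ (fun z => ψ (star z)) ∈ pos
  subdisc : ∀ ψ ∈ pos, ∀ g : 𝔻 → 𝔻, Topology.IsOpenEmbedding g →
    (ψ ∘ g ∈ pos ↔ DiscOrientationPreserving g)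

/-! ### Unpunctured marked surfaces and their mapping class groups -/

/-- An unpunctured surface `(S, M)`: an oriented compact connected surface `S` with boundary, and a
non-empty finite set `M` of marked points on the boundary, at least one on each boundary
component. -/
structure MarkedSurface (S : Type*) [TopologicalSpace S] [T2Space S] [CompactSpace S]
    [ConnectedSpace S] [ChartedSpace (EuclideanHalfSpace 2) S] where
  orientation : SurfaceOrientation S
  marked : Set S
  finite_marked : marked.Finite
  nonempty_marked : marked.Nonempty
  marked_subset : marked ⊆ (𝓡∂ 2).boundary S
  marked_component : ∀ x ∈ (𝓡∂ 2).boundary S,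
    (marked ∩ connectedComponentIn ((𝓡∂ 2).boundary S) x).Nonempty

namespace MarkedSurface

variable {S : Type*} [TopologicalSpace S] [T2Space S] [CompactSpace S] [ConnectedSpace S]
  [ChartedSpace (EuclideanHalfSpace 2) S] (X : MarkedSurface S)

/-- The boundary of the surface. -/
def bdry (_X : MarkedSurface S) : Set S := (𝓡∂ 2).boundary S

/-- `Homeo⁺(S, M)`: the orientation-preserving homeomorphisms of `S` that send `M` to `M`. -/
def HomeoPlus : Subgroup (S ≃ₜ S) where
  carrier := {h | (∀ ψ : 𝔻 → S, h ∘ ψ ∈ X.orientation.pos ↔ ψ ∈ X.orientation.pos) ∧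
    ∀ x, h x ∈ X.marked ↔ x ∈ X.marked}
  mul_mem' := by
    rintro f g ⟨hf, hf'⟩ ⟨hg, hg'⟩
    exact ⟨fun ψ => (hf (g ∘ ψ)).trans (hg ψ), fun x => (hf' (g x)).trans (hg' x)⟩
  one_mem' := ⟨fun _ => Iff.rfl, fun _ => Iff.rfl⟩
  inv_mem' := by
    rintro f ⟨hf, hf'⟩
    refine ⟨fun ψ => ?_, fun x => ?_⟩
    · have h := hf (f.symm ∘ ψ)
      have e : f ∘ (f.symm ∘ ψ) = ψ := by funext z; simp
      rw [e] at h
      exact h.symm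
    · have h := hf' (f.symm x)
      rw [f.apply_symm_apply] at h
      exact h.symm

/-- `h` is isotopic to the identity relative to `M`: it is joined to the identity by a continuous
family of homeomorphisms that fix `M` pointwise. -/
def IsotopicToId (h : S ≃ₜ S) : Prop :=
  ∃ H : I → (S ≃ₜ S), Continuous (fun p : I × S => H p.1 p.2) ∧
    Continuous (fun p : I × S => (H p.1).symm p.2) ∧
    H 0 = Homeomorph.refl S ∧ H 1 = h ∧ ∀ t, ∀ x ∈ X.marked, H t x = x

/-- `Homeo₀(S, M)`: the homeomorphisms in `Homeo⁺(S, M)` that are isotopic to the identity relative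
to `M`. -/
def HomeoZero : Subgroup X.HomeoPlus where
  carrier := {h | X.IsotopicToId h.1}
  mul_mem' := by
    rintro f g ⟨F, hF, hF', F0, F1, FM⟩ ⟨G, hG, hG', G0, G1, GM⟩
    refine ⟨fun t => F t * G t, ?_, ?_, ?_, ?_, ?_⟩
    · exact hF.comp (continuous_fst.prodMk hG)
    · exact hG'.comp (continuous_fst.prodMk hF')
    · simp only [F0, G0]; rfl
    · simp only [F1, G1]; rfl
    · intro t x hx
      change F t (G t x) = x
      rw [GM t x hx, FM t x hx]
  one_mem' := ⟨fun _ => Homeomorph.refl S, continuous_snd, continuous_snd, rfl, rfl,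
    fun _ _ _ => rfl⟩
  inv_mem' := by
    rintro f ⟨F, hF, hF', F0, F1, FM⟩
    refine ⟨fun t => (F t).symm, hF', hF, ?_, ?_, ?_⟩
    · simp only [F0]; rfl
    · simp only [F1]; rfl
    · intro t x hx
      rw [Homeomorph.symm_apply_eq, FM t x hx]

instance homeoZero_normal : X.HomeoZero.Normal where
  conj_mem := by
    rintro f ⟨F, hF, hF', F0, F1, FM⟩ g
    have hg : ∀ x ∈ X.marked, g.1.symm x ∈ X.marked := fun x hx =>
      (g.2.2 (g.1.symm x)).1 (by rw [g.1.apply_symm_apply]; exact hx)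
    refine ⟨fun t => g.1 * F t * g.1⁻¹, ?_, ?_, ?_, ?_, ?_⟩
    · exact g.1.continuous.comp
        (hF.comp (continuous_fst.prodMk (g.1.symm.continuous.comp continuous_snd)))
    · exact g.1.continuous.comp
        (hF'.comp (continuous_fst.prodMk (g.1.symm.continuous.comp continuous_snd)))
    · simp only [F0]
      exact mul_inv_cancel g.1
    · simp only [F1]; rfl
    · intro t x hx
      change g.1 (F t (g.1.symm x)) = x
      rw [FM t _ (hg x hx), g.1.apply_symm_apply]

/-- The mapping class group `MG(S, M) = Homeo⁺(S, M) / Homeo₀(S, M)`. -/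
abbrev MappingClassGroup : Type _ := X.HomeoPlus ⧸ X.HomeoZero

end MarkedSurface

/-! ### Triangulations -/

/-- The corners, in counterclockwise order, of the model triangle in the plane. -/
noncomputable def triVertex (c : Fin 3) : ℂ :=
  Complex.exp (2 * Real.pi * Complex.I * ((c : ℕ) : ℂ) / 3)

/-- The model triangle: a closed equilateral triangle in the plane. -/
def StdTriangle : Set ℂ := convexHull ℝ (Set.range triVertex)

/-- The `c`-th corner as a point of the model triangle. -/
noncomputable def cornerPoint (c : Fin 3) : StdTriangle :=
  ⟨triVertex c, subset_convexHull ℝ _ (Set.mem_range_self c)⟩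

/-- The affine parametrization of the `c`-th side of the model triangle, from corner `c` to
corner `c + 1`, i.e. in the counterclockwise direction. -/
noncomputable def sidePoint (c : Fin 3) (t : I) : StdTriangle :=
  ⟨(1 - (t : ℝ)) • triVertex c + (t : ℝ) • triVertex (c + 1),
    convex_convexHull ℝ _ (subset_convexHull ℝ _ (Set.mem_range_self c)) (subset_convexHull ℝ _ (Set.mem_range_self (c + 1)))
      (sub_nonneg.2 t.2.2) t.2.1 (by ring)⟩

/-- The combinatorics of a triangulation: finitely many arcs and triangles, each triangle having
sides numbered `0, 1, 2` counterclockwise. Every arc `i` is the side `left i` of the triangle on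
its left and the side `right i` of the triangle on its right; these sides are all different. The
remaining sides of triangles are boundary segments. -/
structure TriangleGluing where
  Arc : Type
  Tri : Type
  [fintypeArc : Fintype Arc]
  [fintypeTri : Fintype Tri]
  left : Arc → Tri × Fin 3
  right : Arc → Tri × Fin 3
  injective : Function.Injective (Sum.elim left right)

attribute [instance] TriangleGluing.fintypeArc TriangleGluing.fintypeTri

namespace TriangleGluing

/-- Side `s` (a triangle together with the number of one of its sides) is the arc `i`. -/
def IsSide (G : TriangleGluing) (s : G.Tri × Fin 3) (i : G.Arc) : Prop :=
  G.left i = s ∨ G.right i = s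

/-- A triangle is internal if none of its sides is a boundary segment. -/
def IsInternal (G : TriangleGluing) (D : G.Tri) : Prop :=
  ∀ c, ∃ i, G.IsSide (D, c) i

/-- The two sides of triangles at an arc are glued along the arc. They run along it in opposite
directions, since both are parametrized counterclockwise. -/
inductive Glue (G : TriangleGluing) : G.Tri × StdTriangle → G.Tri × StdTriangle → Prop
  | along (i : G.Arc) (t : I) :
      Glue G ((G.left i).1, sidePoint (G.left i).2 t)
        ((G.right i).1, sidePoint (G.right i).2 (σ t))

end TriangleGluing

/-- A triangulation `T` of the marked surface `(S, M)`: a decomposition of `S` along arcs into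
triangles whose set of vertices is `M`. Each triangle comes with a characteristic map from the model
triangle; `S` is obtained from the disjoint union of the triangles by gluing precisely the two sides
at each arc. The relative interior of an arc is disjoint from the boundary of `S` and the remaining
sides lie on the boundary. The characteristic maps preserve orientation. (As all vertices lie on the
boundary, the collections of arcs that cut `S` into triangles in this way are exactly the maximal
collections of pairwise non-crossing arcs of the unpunctured surface `(S, M)`.) -/
structure Triangulation {S : Type*} [TopologicalSpace S] [T2Space S] [CompactSpace S]
    [ConnectedSpace S] [ChartedSpace (EuclideanHalfSpace 2) S] (X : MarkedSurface S)
    extends TriangleGluing where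
  chart : Tri → StdTriangle → S
  continuous_chart : ∀ D, Continuous (chart D)
  covers : ∀ x, ∃ D z, chart D z = x
  chart_eq_iff : ∀ p q : Tri × StdTriangle, chart p.1 p.2 = chart q.1 q.2 ↔
    Relation.EqvGen toTriangleGluing.Glue p q
  marked_iff : ∀ x, x ∈ X.marked ↔ ∃ D c, chart D (cornerPoint c) = x
  arc_interior : ∀ i, ∀ t : I, 0 < t → t < 1 →
    chart (left i).1 (sidePoint (left i).2 t) ∉ X.bdry
  boundary_side : ∀ s : Tri × Fin 3, (¬ ∃ i, toTriangleGluing.IsSide s i) →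
    ∀ t, chart s.1 (sidePoint s.2 t) ∈ X.bdry
  positive : ∀ (D : Tri) (a : ℂ) (ρ : ℝ), 0 < ρ →
    ∀ h : ∀ z : 𝔻, a + ρ * (z : ℂ) ∈ StdTriangle,
      (fun z : 𝔻 => chart D ⟨a + ρ * (z : ℂ), h z⟩) ∈ X.orientation.pos

/-! ### Path algebras -/

/-- The relations between the generators `e_v` (`v` a vertex) and `a` (an arrow) of a path algebra.
Paths are composed like functions: `b * a` is the path `a` followed by the path `b`. -/
inductive PathRel (k : Type*) [Field k] {V A : Type*} [Fintype V] (s t : A → V) :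
    FreeAlgebra k (V ⊕ A) → FreeAlgebra k (V ⊕ A) → Prop
  | idem (v : V) : PathRel k s t
      (FreeAlgebra.ι k (Sum.inl v) * FreeAlgebra.ι k (Sum.inl v)) (FreeAlgebra.ι k (Sum.inl v))
  | orth (v w : V) (h : v ≠ w) : PathRel k s t
      (FreeAlgebra.ι k (Sum.inl v) * FreeAlgebra.ι k (Sum.inl w)) 0
  | one : PathRel k s t (∑ v, FreeAlgebra.ι k (Sum.inl v)) 1
  | source (a : A) : PathRel k s t
      (FreeAlgebra.ι k (Sum.inr a) * FreeAlgebra.ι k (Sum.inl (s a))) (FreeAlgebra.ι k (Sum.inr a))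
  | target (a : A) : PathRel k s t
      (FreeAlgebra.ι k (Sum.inl (t a)) * FreeAlgebra.ι k (Sum.inr a)) (FreeAlgebra.ι k (Sum.inr a))

/-- The path algebra over `k` of the quiver with finite vertex set `V`, arrow set `A`, and source and
target maps `s` and `t`. -/
abbrev PathAlgebra (k : Type*) [Field k] {V A : Type*} [Fintype V] (s t : A → V) : Type _ :=
  RingQuot (PathRel k s t)

/-- The stationary path at a vertex. -/
noncomputable def PathAlgebra.vertex (k : Type*) [Field k] {V A : Type*} [Fintype V]
    (s t : A → V) (v : V) : PathAlgebra k s t :=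
  RingQuot.mkAlgHom k (PathRel k s t) (FreeAlgebra.ι k (Sum.inl v))

/-- The path of length one given by an arrow. -/
noncomputable def PathAlgebra.arrow (k : Type*) [Field k] {V A : Type*} [Fintype V]
    (s t : A → V) (a : A) : PathAlgebra k s t :=
  RingQuot.mkAlgHom k (PathRel k s t) (FreeAlgebra.ι k (Sum.inr a))

namespace Triangulation

variable {S : Type*} [TopologicalSpace S] [T2Space S] [CompactSpace S] [ConnectedSpace S]
  [ChartedSpace (EuclideanHalfSpace 2) S] {X : MarkedSurface S} (T : Triangulation X)

/-- The arc `i` as a subset of the surface. -/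
def arcSet (i : T.Arc) : Set S :=
  Set.range fun t : I => T.chart (T.left i).1 (sidePoint (T.left i).2 t)

/-- The triangle `D` as a subset of the surface. -/
def triSet (D : T.Tri) : Set S := Set.range (T.chart D)

/-! ### The quiver of a triangulation -/

/-- The arrows of the quiver `Q_T`, whose vertices are the arcs: there is one arrow from `i` to `j`
for each triangle of which `i` and `j` are two sides such that `j` follows `i` counterclockwise,
that is, for each corner of a triangle both of whose sides (the side `corner - 1` ending there and
the side `corner` starting there) are arcs. -/
structure Arrow where
  tri : T.Tri
  corner : Fin 3
  source : T.Arc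
  target : T.Arc
  isSide_source : T.IsSide (tri, corner - 1) source
  isSide_target : T.IsSide (tri, corner) target

/-- An automorphism of the quiver `Q_T`. -/
structure QuiverAut where
  vertex : T.Arc ≃ T.Arc
  arrow : T.Arrow ≃ T.Arrow
  source_arrow : ∀ a, (arrow a).source = vertex a.source
  target_arrow : ∀ a, (arrow a).target = vertex a.target

/-- The mapping class `F` induces the automorphism `φ` of `Q_T`: it has a representative that maps
the arcs of `T` to the arcs of `T`, and the triangles giving rise to arrows to such triangles, in
the way prescribed by `φ`. -/
def MappingClassInduces (F : X.MappingClassGroup) (φ : T.QuiverAut) : Prop :=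
  ∃ h : X.HomeoPlus, (QuotientGroup.mk h : X.MappingClassGroup) = F ∧
    (∀ i, h.1 '' T.arcSet i = T.arcSet (φ.vertex i)) ∧
    ∀ a, h.1 '' T.triSet a.tri = T.triSet (φ.arrow a).tri

/-! ### Admissible cuts -/

/-- An admissible cut of `T` selects a corner in each internal triangle. -/
abbrev AdmissibleCut := {D : T.Tri // T.IsInternal D} → Fin 3

variable {T}

/-- The arrows of `Q_T` distinguished by a cut, one in each internal triangle: the arrow between the
two sides at the selected corner. -/
def AdmissibleCut.arrows (χ : T.AdmissibleCut) : Set T.Arrow :=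
  {a | ∃ h : T.IsInternal a.tri, χ ⟨a.tri, h⟩ = a.corner}

/-- The marked point at which the cut `χ` cuts the internal triangle `D`. -/
noncomputable def AdmissibleCut.point (χ : T.AdmissibleCut) (D : {D : T.Tri // T.IsInternal D}) :
    S :=
  T.chart D.1 (cornerPoint (χ D))

/-- `χ'` is the image of the cut `χ` under the automorphism `φ` of `Q_T`: the local cuts of `χ'` are
the images of the local cuts of `χ`. -/
def AdmissibleCut.IsImage (φ : T.QuiverAut) (χ χ' : T.AdmissibleCut) : Prop :=
  χ'.arrows = φ.arrow '' χ.arrows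

/-- `(χ₁, χ₂)` is equi-distributed: on each boundary component, `χ₁` and `χ₂` have the same number
of local cuts. -/
def EquiDistributed (χ₁ χ₂ : T.AdmissibleCut) : Prop :=
  ∀ x ∈ X.bdry,
    {D | χ₁.point D ∈ connectedComponentIn X.bdry x}.ncard =
      {D | χ₂.point D ∈ connectedComponentIn X.bdry x}.ncard

open Classical in
/-- The weight given by a cut: `1` on the arrows of the cut, `0` on all other arrows. -/
noncomputable def AdmissibleCut.weight (χ : T.AdmissibleCut) (a : T.Arrow) : ℤ :=
  if a ∈ χ.arrows then 1 else 0

/-! ### The Jacobian algebra and its gradings -/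

variable (T) (k : Type*) [Field k]

/-- The relations generating the ideal `I_T`: the paths of length two in the oriented `3`-cycles
given by the internal triangles. -/
inductive JacobianRel : PathAlgebra k (Arrow.source (T := T)) Arrow.target →
    PathAlgebra k (Arrow.source (T := T)) Arrow.target → Prop
  | zero (a b : T.Arrow) (hint : T.IsInternal a.tri) (htri : b.tri = a.tri)
      (hcorner : b.corner = a.corner + 1) :
      JacobianRel (PathAlgebra.arrow k Arrow.source Arrow.target b *
        PathAlgebra.arrow k Arrow.source Arrow.target a) 0

/-- The Jacobian algebra `Λ_T = kQ_T / I_T`. -/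
abbrev JacobianAlgebra : Type _ := RingQuot (T.JacobianRel k)

/-- The class in `Λ_T` of the stationary path at `i`. -/
noncomputable def vertexElt (i : T.Arc) : T.JacobianAlgebra k :=
  RingQuot.mkAlgHom k (T.JacobianRel k) (PathAlgebra.vertex k Arrow.source Arrow.target i)

/-- The class in `Λ_T` of an arrow. -/
noncomputable def arrowElt (a : T.Arrow) : T.JacobianAlgebra k :=
  RingQuot.mkAlgHom k (T.JacobianRel k) (PathAlgebra.arrow k Arrow.source Arrow.target a)

/-- `T.IsPathOfWeight k w p x`: the element `x` of `Λ_T` is the class of a path of weight `p` with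
respect to the weight function `w` (products of arrows that do not compose are `0`). -/
inductive IsPathOfWeight (w : T.Arrow → ℤ) : ℤ → T.JacobianAlgebra k → Prop
  | stationary (i : T.Arc) : IsPathOfWeight w 0 (T.vertexElt k i)
  | cons (a : T.Arrow) (p : ℤ) (x : T.JacobianAlgebra k) (hx : IsPathOfWeight w p x) :
      IsPathOfWeight w (w a + p) (T.arrowElt k a * x)

/-- The component `Λ^p` of the grading of `Λ = Λ_T` induced by the weight function `w`. -/
def gradedPart (w : T.Arrow → ℤ) (p : ℤ) : Submodule k (T.JacobianAlgebra k) :=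
  Submodule.span k {x | T.IsPathOfWeight k w p x}

/-- The component of degree `d` of the graded right module `N = ⨁ᵢ Pᵢ⟨rᵢ⟩`, where `Pᵢ = eᵢ Λ` is
graded by the weight `w` and `(P⟨q⟩)^d = P^(d + q)`. The underlying module of `N` is
`⨁ᵢ eᵢ Λ = Λ`. -/
def shiftedPart (w : T.Arrow → ℤ) (r : T.Arc → ℤ) (d : ℤ) : Set (T.JacobianAlgebra k) :=
  {x | ∀ i, T.vertexElt k i * x ∈ T.gradedPart k w (d + r i)}

/-- The space `Hom_{Cov Λ}(⨁ᵢ Pᵢ⟨rᵢ⟩, ⨁ᵢ Pᵢ⟨rᵢ + p⟩)` of homomorphisms of graded right modules,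
for the grading given by `w`. It consists of the endomorphisms of the right module `⨁ᵢ Pᵢ = Λ` that
raise the degree in `⨁ᵢ Pᵢ⟨rᵢ⟩` by `p`. -/
def shiftedHom (w : T.Arrow → ℤ) (r : T.Arc → ℤ) (p : ℤ) :
    Set (Module.End (T.JacobianAlgebra k)ᵐᵒᵖ (T.JacobianAlgebra k)) :=
  {u | ∀ d, ∀ x ∈ T.shiftedPart k w r d, u x ∈ T.shiftedPart k w r (d + p)}

variable {T}

/-- A graded equivalence between the graded algebras `Λ̃₁` and `Λ̃₂` given by the cuts `χ₁` and `χ₂`: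
a map `r` from the vertices of `Q_T` to `ℤ` and an isomorphism of graded algebras
`Λ̃₂ ≅ ⨁ₚ Hom_{Cov Λ̃₁}(⨁ᵢ Pᵢ⟨rᵢ⟩, ⨁ᵢ Pᵢ⟨rᵢ + p⟩)`. The algebra underlying the right-hand side is
the endomorphism algebra of the right module `⨁ᵢ Pᵢ = Λ_T`. -/
structure GradedEquivalence (χ₁ χ₂ : T.AdmissibleCut) where
  r : T.Arc → ℤ
  iso : T.JacobianAlgebra k ≃ₐ[k] Module.End (T.JacobianAlgebra k)ᵐᵒᵖ (T.JacobianAlgebra k)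
  graded : ∀ p x, x ∈ T.gradedPart k χ₂.weight p ↔ iso x ∈ T.shiftedHom k χ₁.weight r p

variable {k}

/-- The map `f : Λ̃₁ → Λ̃₂` of a graded equivalence. Here `Λ_T` acts on the right module `Λ_T` by left
multiplication, which identifies `Λ_T` with the endomorphism algebra. -/
noncomputable def GradedEquivalence.map {χ₁ χ₂ : T.AdmissibleCut}
    (E : GradedEquivalence k χ₁ χ₂) : T.JacobianAlgebra k →ₐ[k] T.JacobianAlgebra k :=
  (E.iso.symm : _ →ₐ[k] _).comp
    (Algebra.lsmul k (T.JacobianAlgebra k)ᵐᵒᵖ (T.JacobianAlgebra k))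

variable (T k) in
/-- The arrow ideal (which is the radical) of `Λ_T`, as a subspace. -/
def arrowIdeal : Submodule k (T.JacobianAlgebra k) :=
  Submodule.span k {x | ∃ y a z, x = y * T.arrowElt k a * z}

/-- An algebra homomorphism `f` of `Λ_T` induces the automorphism `φ` of `Q_T`: modulo the arrow
ideal it maps `eᵢ` to `e_{φ i}`, and modulo the square of the arrow ideal it maps each arrow `a` to a
nonzero scalar multiple of the arrow `φ a`. -/
def AlgHomInduces (f : T.JacobianAlgebra k →ₐ[k] T.JacobianAlgebra k) (φ : T.QuiverAut) : Prop :=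
  (∀ i, f (T.vertexElt k i) - T.vertexElt k (φ.vertex i) ∈ T.arrowIdeal k) ∧
  ∀ a, ∃ c : k, c ≠ 0 ∧
    f (T.arrowElt k a) - c • T.arrowElt k (φ.arrow a) ∈ T.arrowIdeal k ^ 2

end Triangulation

/-! The quiver alone need not remember which composable arrows lie in a common triangle, but the
relations do. If `b a = 0` is a relation, then expanding `f(b) f(a) = 0` modulo the cube of the
arrow ideal shows that a nonzero multiple of `φ(b) φ(a)` lies in that cube. A three-dimensional
representation excludes this unless `φ(b) φ(a)` is itself a relation (`AlgHomInduces.relation`). So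
`φ` maps the 3-cycles of internal triangles to such 3-cycles, preserving their cyclic order. A
non-internal triangle carries at most one arrow.

Consequently `φ` lifts to a permutation of the sides of the arcs that respects succession in
triangles, that is, to a permutation of the triangles with a rotation of each, compatible with the
gluing (`QuiverAut.PreservesRelations.exists_automorphism`). Rotating the model triangles
accordingly is compatible with the identifications along the arcs and descends to a homeomorphism
(`realize`). It preserves orientation because on small round discs inside a triangle it is a
rotation (`realize_comp_mem_pos`).

For the cuts, the element `f(a)` acts as left multiplication by `a` on the shifted module, so the
weight of `φ(a)` for the second cut is that of `a` for the first plus `r` at the source minus `r` at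
the target (`GradedEquivalence.weight_arrow`). Equi-distribution is then a discrete Stokes argument
(`equiDistributed_of_weight`): counting cuts at a boundary component pairs the weight with an
indicator function of corners. In the pairing with a coboundary, the two sides of each arc cancel
because they run along it in opposite directions, and a boundary side contributes nothing because
both its ends lie on one component. -/

/-- The matrices whose entries vanish above the `p`-th lower diagonal. -/
def lowerMatrices (k : Type*) [Field k] (n p : ℕ) : Submodule k (Matrix (Fin n) (Fin n) k) where
  carrier := {M | ∀ i j : Fin n, (i : ℕ) < j + p → M i j = 0}
  add_mem' := by
    intro M N hM hN i j h
    simp [hM i j h, hN i j h]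
  zero_mem' := by intro i j _; rfl
  smul_mem' := by
    intro c M hM i j h
    simp [hM i j h]

theorem mul_mem_lowerMatrices {k : Type*} [Field k] {n p q : ℕ} {M N : Matrix (Fin n) (Fin n) k}
    (hM : M ∈ lowerMatrices k n p) (hN : N ∈ lowerMatrices k n q) :
    M * N ∈ lowerMatrices k n (p + q) := by
  intro i j h
  rw [Matrix.mul_apply]
  refine Finset.sum_eq_zero fun l _ => ?_
  by_cases hl : (i : ℕ) < l + p
  · rw [hM i l hl, zero_mul]
  · rw [hN l j (by omega), mul_zero]

namespace Triangulation

variable {S : Type*} [TopologicalSpace S] [T2Space S] [CompactSpace S] [ConnectedSpace S]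
  [ChartedSpace (EuclideanHalfSpace 2) S] {X : MarkedSurface S} {T : Triangulation X}

theorem isSide_unique {s : T.Tri × Fin 3} {i j : T.Arc} (hi : T.IsSide s i) (hj : T.IsSide s j) :
    i = j := by
  rcases hi with hi | hi <;> rcases hj with hj | hj
  · exact Sum.inl_injective (T.injective (a₁ := Sum.inl i) (a₂ := Sum.inl j) (hi.trans hj.symm))
  · cases T.injective (a₁ := Sum.inl i) (a₂ := Sum.inr j) (hi.trans hj.symm)
  · cases T.injective (a₁ := Sum.inr i) (a₂ := Sum.inl j) (hi.trans hj.symm)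
  · exact Sum.inr_injective (T.injective (a₁ := Sum.inr i) (a₂ := Sum.inr j) (hi.trans hj.symm))

/-- The source and the target are arcs lying on prescribed sides, and a side is a side of at most
one arc. -/
theorem arrow_ext {a b : T.Arrow} (ht : a.tri = b.tri) (hc : a.corner = b.corner) : a = b := by
  obtain ⟨t, c, s, g, hs, hg⟩ := a
  obtain ⟨t', c', s', g', hs', hg'⟩ := b
  obtain rfl : t = t' := ht
  obtain rfl : c = c' := hc
  obtain rfl := isSide_unique hs hs'
  obtain rfl := isSide_unique hg hg'
  rfl

variable {k : Type*} [Field k]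

/-! ### Matrix representations of the Jacobian algebra -/

section Representation

open Classical in
/-- The representation of the Jacobian algebra in which the `l`-th basis vector sits at the vertex
`v l` and the arrow `a` acts by the matrix `m a`. -/
noncomputable def matrixRep {n : ℕ} (v : Fin n → T.Arc) (m : T.Arrow → Matrix (Fin n) (Fin n) k)
    (hm : ∀ a i j, m a i j ≠ 0 → v j = a.source ∧ v i = a.target)
    (hrel : ∀ a b : T.Arrow, T.IsInternal a.tri → b.tri = a.tri → b.corner = a.corner + 1 →
      m b * m a = 0) :
    T.JacobianAlgebra k →ₐ[k] Matrix (Fin n) (Fin n) k :=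
  RingQuot.liftAlgHom k ⟨RingQuot.liftAlgHom k ⟨FreeAlgebra.lift k
    (Sum.elim (fun i => Matrix.diagonal fun l => if v l = i then 1 else 0) m), by
      rintro _ _ (i | ⟨i, j, hij⟩ | _ | a | a)
      · simp
      · simp only [map_mul, map_zero, FreeAlgebra.lift_ι_apply, Sum.elim_inl,
          Matrix.diagonal_mul_diagonal]
        rw [← Matrix.diagonal_zero]
        congr 1
        funext l
        by_cases h : v l = i <;> simp [h, hij]
      · simp only [map_sum, map_one, FreeAlgebra.lift_ι_apply, Sum.elim_inl]
        ext x y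
        rw [Matrix.sum_apply]
        by_cases h : x = y
        · subst h; simp
        · simp [h]
      · simp only [map_mul, FreeAlgebra.lift_ι_apply, Sum.elim_inl, Sum.elim_inr]
        ext x y
        rw [Matrix.mul_diagonal]
        by_cases h : m a x y = 0
        · simp [h]
        · simp [(hm a x y h).1]
      · simp only [map_mul, FreeAlgebra.lift_ι_apply, Sum.elim_inl, Sum.elim_inr]
        ext x y
        rw [Matrix.diagonal_mul]
        by_cases h : m a x y = 0
        · simp [h]
        · simp [(hm a x y h).2]⟩, by
      rintro _ _ ⟨a, b, hint, htri, hcorner⟩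
      simpa [PathAlgebra.arrow] using hrel a b hint htri hcorner⟩

variable {n : ℕ} {v : Fin n → T.Arc} {m : T.Arrow → Matrix (Fin n) (Fin n) k}
  {hm : ∀ a i j, m a i j ≠ 0 → v j = a.source ∧ v i = a.target}
  {hrel : ∀ a b : T.Arrow, T.IsInternal a.tri → b.tri = a.tri → b.corner = a.corner + 1 →
    m b * m a = 0}

theorem matrixRep_arrowElt (a : T.Arrow) : matrixRep v m hm hrel (T.arrowElt k a) = m a := by
  simp [matrixRep, arrowElt, PathAlgebra.arrow]

open Classical in
theorem matrixRep_vertexElt (i : T.Arc) : matrixRep v m hm hrel (T.vertexElt k i) =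
    Matrix.diagonal fun l => if v l = i then 1 else 0 := by
  simp [matrixRep, vertexElt, PathAlgebra.vertex]

theorem jacobianAlgebra_induction {P : T.JacobianAlgebra k → Prop}
    (algebraMap : ∀ c, P (algebraMap k _ c)) (vertex : ∀ i, P (T.vertexElt k i))
    (arrow : ∀ a, P (T.arrowElt k a)) (add : ∀ x y, P x → P y → P (x + y))
    (mul : ∀ x y, P x → P y → P (x * y)) (x : T.JacobianAlgebra k) : P x := by
  obtain ⟨x, rfl⟩ := RingQuot.mkAlgHom_surjective k (T.JacobianRel k) x
  obtain ⟨x, rfl⟩ := RingQuot.mkAlgHom_surjective k _ x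
  induction x using FreeAlgebra.induction with
  | grade0 c => simpa using algebraMap c
  | grade1 z =>
    rcases z with i | a
    · exact vertex i
    · exact arrow a
  | mul x y hx hy => simpa using mul _ _ hx hy
  | add x y hx hy => simpa using add _ _ hx hy

theorem matrixRep_mem_lowerMatrices (hlow : ∀ a, m a ∈ lowerMatrices k n 1)
    (x : T.JacobianAlgebra k) : matrixRep v m hm hrel x ∈ lowerMatrices k n 0 := by
  induction x using jacobianAlgebra_induction with
  | algebraMap c =>
    rw [AlgHom.commutes]
    intro i j h
    rw [Matrix.algebraMap_matrix_apply, if_neg (by rintro rfl; omega)]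
  | vertex l =>
    rw [matrixRep_vertexElt]
    intro i j h
    exact Matrix.diagonal_apply_ne _ (by rintro rfl; omega)
  | arrow a =>
    rw [matrixRep_arrowElt]
    intro i j h
    exact hlow a i j (by omega)
  | add x y hx hy => rw [map_add]; exact add_mem hx hy
  | mul x y hx hy => rw [map_mul]; exact mul_mem_lowerMatrices hx hy

theorem matrixRep_arrowIdeal (hlow : ∀ a, m a ∈ lowerMatrices k n 1)
    {x : T.JacobianAlgebra k} (hx : x ∈ T.arrowIdeal k) :
    matrixRep v m hm hrel x ∈ lowerMatrices k n 1 := by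
  have h : T.arrowIdeal k ≤ (lowerMatrices k n 1).comap (matrixRep v m hm hrel).toLinearMap := by
    refine Submodule.span_le.2 ?_
    rintro _ ⟨y, a, z, rfl⟩
    change matrixRep v m hm hrel _ ∈ lowerMatrices k n 1
    rw [map_mul, map_mul, matrixRep_arrowElt]
    exact mul_mem_lowerMatrices (p := 1) (q := 0) (mul_mem_lowerMatrices (p := 0) (q := 1)
      (matrixRep_mem_lowerMatrices hlow y) (hlow a)) (matrixRep_mem_lowerMatrices hlow z)
  exact h hx

/-- Each arrow pushes basis vectors strictly down, so a product of `p` arrows pushes them down by at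
least `p`. A nonzero entry on a higher diagonal therefore certifies that an element is not in the
`p`-th power of the arrow ideal. -/
theorem matrixRep_arrowIdeal_pow (hlow : ∀ a, m a ∈ lowerMatrices k n 1) (p : ℕ)
    {x : T.JacobianAlgebra k} (hx : x ∈ T.arrowIdeal k ^ p) :
    matrixRep v m hm hrel x ∈ lowerMatrices k n p := by
  induction p generalizing x with
  | zero => exact matrixRep_mem_lowerMatrices hlow x
  | succ p ih =>
    rw [pow_succ] at hx
    induction hx using Submodule.mul_induction_on' with
    | mem_mul_mem y hy z hz =>
      rw [map_mul]
      exact mul_mem_lowerMatrices (ih hy) (matrixRep_arrowIdeal hlow hz)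
    | add y _ z _ hy hz => rw [map_add]; exact add_mem hy hz

end Representation

/-! ### Detecting the relations with a three-dimensional representation -/

theorem eq_add_of_sub_mem {J : Submodule k (T.JacobianAlgebra k)} {x y : T.JacobianAlgebra k}
    (h : x - y ∈ J) : ∃ z ∈ J, x = z + y :=
  ⟨x - y, h, (sub_add_cancel x y).symm⟩

theorem arrowElt_mem_arrowIdeal (a : T.Arrow) : T.arrowElt k a ∈ T.arrowIdeal k :=
  Submodule.subset_span ⟨1, a, 1, by simp⟩

theorem arrowElt_mul_vertexElt (a : T.Arrow) :
    T.arrowElt k a * T.vertexElt k a.source = T.arrowElt k a := by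
  have h := congrArg (RingQuot.mkAlgHom k (T.JacobianRel k))
    (RingQuot.mkAlgHom_rel k (PathRel.source (k := k) (s := Arrow.source (T := T))
      (t := Arrow.target) a))
  simpa [arrowElt, vertexElt, PathAlgebra.arrow, PathAlgebra.vertex] using h

theorem vertexElt_mul_arrowElt (a : T.Arrow) :
    T.vertexElt k a.target * T.arrowElt k a = T.arrowElt k a := by
  have h := congrArg (RingQuot.mkAlgHom k (T.JacobianRel k))
    (RingQuot.mkAlgHom_rel k (PathRel.target (k := k) (s := Arrow.source (T := T))
      (t := Arrow.target) a))
  simpa [arrowElt, vertexElt, PathAlgebra.arrow, PathAlgebra.vertex] using h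

theorem vertexElt_mul_vertexElt {i j : T.Arc} (hij : i ≠ j) :
    T.vertexElt k i * T.vertexElt k j = 0 := by
  have h := congrArg (RingQuot.mkAlgHom k (T.JacobianRel k))
    (RingQuot.mkAlgHom_rel k (PathRel.orth (k := k) (s := Arrow.source (T := T))
      (t := Arrow.target) i j hij))
  simpa [vertexElt, PathAlgebra.vertex] using h

theorem arrowElt_mul_arrowElt {a b : T.Arrow} (hint : T.IsInternal a.tri) (htri : b.tri = a.tri)
    (hcorner : b.corner = a.corner + 1) : T.arrowElt k b * T.arrowElt k a = 0 := by
  have h := RingQuot.mkAlgHom_rel k (JacobianRel.zero (k := k) a b hint htri hcorner)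
  simpa [arrowElt] using h

open Classical in
/-- A product of two composable arrows which is not among the relations is not in the cube of the
arrow ideal. -/
theorem relation_of_mem_arrowIdeal_pow {a b : T.Arrow} (hab : a.target = b.source)
    (h : T.arrowElt k b * T.arrowElt k a ∈ T.arrowIdeal k ^ 3) :
    T.IsInternal a.tri ∧ b.tri = a.tri ∧ b.corner = a.corner + 1 := by
  by_contra hcon
  -- Basis vectors are positions along the path `b a`, not vertices. The matrices thus stay strictly
  -- lower triangular even if vertices repeat or `a = b`.
  let v : Fin 3 → T.Arc := ![a.source, a.target, b.target]
  let m : T.Arrow → Matrix (Fin 3) (Fin 3) k := fun c =>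
    !![0, 0, 0; if c = a then 1 else 0, 0, 0; 0, if c = b then 1 else 0, 0]
  have hm : ∀ c i j, m c i j ≠ 0 → v j = c.source ∧ v i = c.target := by
    intro c i j
    fin_cases i <;> fin_cases j <;> simp [m, v]
    · rintro rfl; simp
    · rintro rfl; simp [hab]
  have hmul : ∀ c d, m d * m c =
      !![0, 0, 0; 0, 0, 0; (if d = b then 1 else 0) * (if c = a then 1 else 0), 0, 0] := by
    intro c d
    ext i j
    fin_cases i <;> fin_cases j <;> simp [m, Matrix.mul_apply, Fin.sum_univ_three]
  -- The only nonzero product of two arrow matrices is that of `b` with `a`, which is not a relation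
  -- by assumption.
  have hrel : ∀ c d : T.Arrow, T.IsInternal c.tri → d.tri = c.tri → d.corner = c.corner + 1 →
      m d * m c = 0 := by
    intro c d h1 h2 h3
    have hcd : ¬ (d = b ∧ c = a) := by
      rintro ⟨rfl, rfl⟩
      exact hcon ⟨h1, h2, h3⟩
    rw [hmul]
    ext i j
    fin_cases i <;> fin_cases j <;> simp
    tauto
  have hlow : ∀ c, m c ∈ lowerMatrices k 3 1 := by
    intro c i j
    fin_cases i <;> fin_cases j <;> simp [m]
  -- The entry `(2, 0)` vanishes on the cube of the arrow ideal, but it equals `1` at `b a`.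
  have key := matrixRep_arrowIdeal_pow (v := v) (hm := hm) (hrel := hrel) hlow 3 h 2 0 (by simp)
  rw [map_mul, matrixRep_arrowElt, matrixRep_arrowElt, hmul] at key
  simp at key

/-- The arrows of a relation of the Jacobian algebra are mapped to the arrows of a relation. -/
theorem AlgHomInduces.relation {f : T.JacobianAlgebra k →ₐ[k] T.JacobianAlgebra k} {φ : T.QuiverAut}
    (hf : AlgHomInduces f φ) {a b : T.Arrow} (hint : T.IsInternal a.tri) (htri : b.tri = a.tri)
    (hcorner : b.corner = a.corner + 1) :
    T.IsInternal (φ.arrow a).tri ∧ (φ.arrow b).tri = (φ.arrow a).tri ∧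
      (φ.arrow b).corner = (φ.arrow a).corner + 1 := by
  have hs : b.source = a.target := by
    refine isSide_unique (s := (a.tri, a.corner)) ?_ a.isSide_target
    have := b.isSide_source
    rwa [htri, hcorner, add_sub_cancel_right] at this
  refine relation_of_mem_arrowIdeal_pow (k := k)
    (by rw [φ.target_arrow, φ.source_arrow, hs]) ?_
  obtain ⟨c, hc, ha⟩ := hf.2 a
  obtain ⟨d, hd, hb⟩ := hf.2 b
  have h0 : f (T.arrowElt k b) * f (T.arrowElt k a) = 0 := by
    rw [← map_mul, arrowElt_mul_arrowElt hint htri hcorner, map_zero]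
  obtain ⟨u, hu, ha⟩ := eq_add_of_sub_mem ha
  obtain ⟨z, hz, hb⟩ := eq_add_of_sub_mem hb
  set x := f (T.arrowElt k a)
  set y := f (T.arrowElt k b)
  set p := T.arrowElt k (φ.arrow a) with hp
  set q := T.arrowElt k (φ.arrow b) with hq
  have hpJ : c • p ∈ T.arrowIdeal k := Submodule.smul_mem _ _ (arrowElt_mem_arrowIdeal _)
  have hqJ : q ∈ T.arrowIdeal k := arrowElt_mem_arrowIdeal _
  have hxJ : x ∈ T.arrowIdeal k := by
    have h2 : T.arrowIdeal k ^ 2 ≤ T.arrowIdeal k := by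
      rw [pow_two]
      refine Submodule.mul_le.2 fun u hu w _ => ?_
      induction hu using Submodule.span_induction with
      | mem u hu =>
        obtain ⟨y, a, z, rfl⟩ := hu
        exact Submodule.subset_span ⟨y, a, z * w, by rw [mul_assoc]⟩
      | zero => rw [zero_mul]; exact zero_mem _
      | add u u' _ _ h h' => rw [add_mul]; exact add_mem h h'
      | smul t u _ h => rw [smul_mul_assoc]; exact Submodule.smul_mem _ _ h
    rw [ha]
    exact add_mem (h2 hu) hpJ
  have h1 : z * x ∈ T.arrowIdeal k ^ 3 := by
    rw [pow_succ]; exact Submodule.mul_mem_mul hz hxJ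
  have h2 : (d • q) * u ∈ T.arrowIdeal k ^ 3 := by
    rw [pow_succ']; exact Submodule.mul_mem_mul (Submodule.smul_mem _ _ hqJ) hu
  -- This is `f(b) f(a) = 0` with `f(b) = z + d q` and `f(a) = x = u + c p`; the terms containing
  -- the errors `z` and `u` lie in the cube.
  have h3 : (z * x + (d • q) * u) + (d * c) • (q * p) = 0 := by
    rw [← h0, hb, add_mul, add_assoc, ← smul_mul_smul_comm, ← mul_add, ← ha]
  have h4 : (d * c) • (q * p) = (-1 : k) • (z * x + (d • q) * u) := by
    have h5 : (-1 : k) • (z * x + (d • q) * u) + (z * x + (d • q) * u) = 0 := by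
      nth_rewrite 2 [← one_smul k (z * x + (d • q) * u)]
      rw [← add_smul, neg_add_cancel, zero_smul]
    rw [← zero_add ((d * c) • (q * p)), ← h5, add_assoc, h3, add_zero]
  refine (Submodule.smul_mem_iff _ (mul_ne_zero hd hc)).1 ?_
  rw [h4]
  exact Submodule.smul_mem _ _ (add_mem h1 h2)

/-! ### Weights of corresponding arrows -/

open Classical in
/-- If an element of degree `p` involves the arrow `b`, then `b` has weight `p`. -/
theorem weight_eq_of_mem_gradedPart {w : T.Arrow → ℤ} {p : ℤ} {b : T.Arrow} {c : k} (hc : c ≠ 0)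
    {x : T.JacobianAlgebra k} (hx : x ∈ T.gradedPart k w p)
    (h : x - c • T.arrowElt k b ∈ T.arrowIdeal k ^ 2) : w b = p := by
  by_contra hne
  let v : Fin 2 → T.Arc := ![b.source, b.target]
  let m : T.Arrow → Matrix (Fin 2) (Fin 2) k := fun a => !![0, 0; if a = b then 1 else 0, 0]
  have hm : ∀ a i j, m a i j ≠ 0 → v j = a.source ∧ v i = a.target := by
    intro a i j
    fin_cases i <;> fin_cases j <;> simp [m, v]
    rintro rfl; simp
  have hrel : ∀ c d : T.Arrow, T.IsInternal c.tri → d.tri = c.tri → d.corner = c.corner + 1 →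
      m d * m c = 0 := by
    intro c d _ _ _
    ext i j
    fin_cases i <;> fin_cases j <;> simp [m, Matrix.mul_apply]
  have hlow : ∀ c, m c ∈ lowerMatrices k 2 1 := by
    intro c i j
    fin_cases i <;> fin_cases j <;> simp [m]
  -- Entry `(1, 0)` of `b * y` is entry `(0, 0)` of `y`. The latter is nonzero only for stationary
  -- paths, which have weight `0`, so both entries are tracked together.
  have hpath : ∀ q y, T.IsPathOfWeight k w q y →
      (q ≠ 0 → matrixRep v m hm hrel y 0 0 = 0) ∧
        (q ≠ w b → matrixRep v m hm hrel y 1 0 = 0) := by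
    intro q y hy
    induction hy with
    | stationary i => simp [matrixRep_vertexElt]
    | cons a q y hy ih =>
      rw [map_mul, matrixRep_arrowElt]
      refine ⟨fun _ => by simp [m, Matrix.mul_apply], fun hq => ?_⟩
      by_cases hab : a = b
      · subst hab
        have := ih.1 (by rintro rfl; simp at hq)
        simp [m, Matrix.mul_apply, this]
      · simp [m, Matrix.mul_apply, hab]
  have hx0 : matrixRep v m hm hrel x 1 0 = 0 := by
    clear h
    induction hx using Submodule.span_induction with
    | mem y hy => exact (hpath p y hy).2 (Ne.symm hne)
    | zero => simp
    | add y z _ _ hy hz => rw [map_add, Matrix.add_apply, hy, hz, add_zero]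
    | smul t y _ hy => rw [map_smul, Matrix.smul_apply, hy, smul_zero]
  obtain ⟨u, hu, rfl⟩ := eq_add_of_sub_mem h
  have hu0 : matrixRep v m hm hrel u 1 0 = 0 :=
    matrixRep_arrowIdeal_pow hlow 2 hu 1 0 (by simp)
  rw [map_add, Matrix.add_apply, hu0, zero_add, map_smul, matrixRep_arrowElt] at hx0
  simp [m, hc] at hx0

/-- Under a graded equivalence the weights of corresponding arrows differ by a coboundary. -/
theorem GradedEquivalence.weight_arrow {χ₁ χ₂ : T.AdmissibleCut} (E : GradedEquivalence k χ₁ χ₂)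
    {φ : T.QuiverAut} (hφ : AlgHomInduces E.map φ) (a : T.Arrow) :
    χ₂.weight (φ.arrow a) = χ₁.weight a + (E.r a.source - E.r a.target) := by
  obtain ⟨c, hc, h⟩ := hφ.2 a
  -- It remains to find the degree of left multiplication by `a`. It maps the component at the
  -- source `s`, of degree `d + r s`, into the component at the target `t`. The new degree is the
  -- weight of `a` plus `d + r s`, which is `(d + p) + r t` for the asserted `p`.
  refine weight_eq_of_mem_gradedPart hc ((E.graded _ _).2 ?_) h
  have hiso : E.iso (E.map (T.arrowElt k a)) =
      Algebra.lsmul k (T.JacobianAlgebra k)ᵐᵒᵖ (T.JacobianAlgebra k) (T.arrowElt k a) :=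
    E.iso.apply_symm_apply _
  rw [hiso]
  intro d x hx i
  change T.vertexElt k i * (T.arrowElt k a * x) ∈ _
  by_cases hi : i = a.target
  · subst hi
    rw [← mul_assoc, vertexElt_mul_arrowElt, ← arrowElt_mul_vertexElt, mul_assoc]
    have hx' := hx a.source
    have e : d + (χ₁.weight a + (E.r a.source - E.r a.target)) + E.r a.target =
        χ₁.weight a + (d + E.r a.source) := by ring
    rw [e]
    generalize T.vertexElt k a.source * x = y at hx'
    induction hx' using Submodule.span_induction with
    | mem y hy => exact Submodule.subset_span (IsPathOfWeight.cons a _ y hy)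
    | zero => rw [mul_zero]; exact zero_mem _
    | add y z _ _ hy hz => rw [mul_add]; exact add_mem hy hz
    | smul t y _ hy => rw [mul_smul_comm]; exact Submodule.smul_mem _ _ hy
  · rw [← vertexElt_mul_arrowElt, ← mul_assoc, ← mul_assoc, vertexElt_mul_vertexElt hi, zero_mul,
      zero_mul]
    exact zero_mem _

end Triangulation

/-! ### Automorphisms of the gluing pattern -/

namespace TriangleGluing

variable (G : TriangleGluing)

/-- The two sides of the arcs: `inl i` is the side of the arc `i` in the triangle on its left, and
`inr i` the one in the triangle on its right. -/
def arcSide : G.Arc ⊕ G.Arc → G.Tri × Fin 3 := Sum.elim G.left G.right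

variable {G}

/-- The arc of which `x` is a side. -/
def arcOf : G.Arc ⊕ G.Arc → G.Arc := Sum.elim id id

theorem arcSide_injective : Function.Injective G.arcSide := G.injective

@[simp] theorem arcOf_swap (x : G.Arc ⊕ G.Arc) : arcOf x.swap = arcOf x := by
  rcases x with i | i <;> rfl

theorem swap_ne (x : G.Arc ⊕ G.Arc) : x.swap ≠ x := by
  rcases x with i | i <;> simp

theorem eq_or_eq_swap {x y : G.Arc ⊕ G.Arc} (h : arcOf x = arcOf y) : y = x ∨ y = x.swap := by
  rcases x with i | i <;> rcases y with j | j <;> simp_all [arcOf]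

theorem isSide_iff {s : G.Tri × Fin 3} {i : G.Arc} :
    G.IsSide s i ↔ ∃ x, G.arcSide x = s ∧ arcOf x = i := by
  constructor
  · rintro (h | h)
    · exact ⟨Sum.inl i, h, rfl⟩
    · exact ⟨Sum.inr i, h, rfl⟩
  · rintro ⟨i | i, h, rfl⟩
    · exact Or.inl h
    · exact Or.inr h

/-- The side `y` follows the side `x` counterclockwise in some triangle. -/
def Follows (x y : G.Arc ⊕ G.Arc) : Prop :=
  G.arcSide y = ((G.arcSide x).1, (G.arcSide x).2 + 1)

theorem follows_or_follows {x y : G.Arc ⊕ G.Arc} (hxy : x ≠ y)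
    (h : (G.arcSide x).1 = (G.arcSide y).1) : Follows x y ∨ Follows y x := by
  have hc : (G.arcSide x).2 ≠ (G.arcSide y).2 := fun hc =>
    hxy (arcSide_injective (Prod.ext h hc))
  have key : ∀ c d : Fin 3, c ≠ d → d = c + 1 ∨ c = d + 1 := by decide
  rcases key _ _ hc with h' | h'
  · exact Or.inl (Prod.ext h.symm h')
  · exact Or.inr (Prod.ext h h')

/-- An automorphism of the combinatorial pattern of a triangulation: it permutes the triangles,
numbering their sides anew by a rotation, and permutes the arcs accordingly. -/
structure Automorphism (G : TriangleGluing) where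
  tri : Equiv.Perm G.Tri
  rot : G.Tri → Fin 3
  arc : Equiv.Perm G.Arc
  side : Equiv.Perm (G.Arc ⊕ G.Arc)
  arcOf_side : ∀ x, arcOf (side x) = arc (arcOf x)
  arcSide_side : ∀ x, G.arcSide (side x) =
    (tri (G.arcSide x).1, (G.arcSide x).2 + rot (G.arcSide x).1)

/-- Both sides of an arc go to sides of the image arc, and injectivity forces them to be its two
different sides. This is the compatibility with the gluing. -/
theorem Automorphism.side_swap (A : G.Automorphism) (x : G.Arc ⊕ G.Arc) :
    A.side x.swap = (A.side x).swap := by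
  have h : arcOf (A.side x) = arcOf (A.side x.swap) := by
    rw [A.arcOf_side, A.arcOf_side, arcOf_swap]
  exact (eq_or_eq_swap h).resolve_left fun h => swap_ne x (A.side.injective h)

open Classical in
/-- A permutation of the sides of the arcs which respects the arcs and the cyclic order of the sides
in the triangles comes from an automorphism. -/
theorem exists_automorphism (π : Equiv.Perm G.Arc) (Φ : Equiv.Perm (G.Arc ⊕ G.Arc))
    (hπ : ∀ x, arcOf (Φ x) = π (arcOf x)) (hΦ : ∀ x y, Follows (Φ x) (Φ y) ↔ Follows x y) :
    ∃ A : G.Automorphism, A.arc = π ∧ A.side = Φ := by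
  have hpair : ∀ x y, (G.arcSide (Φ x)).1 = (G.arcSide (Φ y)).1 ↔
      (G.arcSide x).1 = (G.arcSide y).1 := by
    have h1 : ∀ x y, Follows x y → (G.arcSide x).1 = (G.arcSide y).1 := fun x y h => by
      rw [h]
    intro x y
    by_cases hxy : x = y
    · subst hxy; simp
    constructor
    · intro h
      rcases follows_or_follows (Φ.injective.ne hxy) h with h | h
      · exact h1 _ _ ((hΦ _ _).1 h)
      · exact (h1 _ _ ((hΦ _ _).1 h)).symm
    · intro h
      rcases follows_or_follows hxy h with h | h
      · exact h1 _ _ ((hΦ _ _).2 h)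
      · exact (h1 _ _ ((hΦ _ _).2 h)).symm
  have hrot : ∀ x y, (G.arcSide x).1 = (G.arcSide y).1 →
      (G.arcSide (Φ x)).2 - (G.arcSide x).2 = (G.arcSide (Φ y)).2 - (G.arcSide y).2 := by
    have h1 : ∀ x y, Follows x y →
        (G.arcSide (Φ x)).2 - (G.arcSide x).2 = (G.arcSide (Φ y)).2 - (G.arcSide y).2 := by
      intro x y h
      have h' : G.arcSide (Φ y) = _ := (hΦ _ _).2 h
      have h : G.arcSide y = _ := h
      rw [h, h']
      simp
    intro x y h
    by_cases hxy : x = y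
    · subst hxy; rfl
    rcases follows_or_follows hxy h with h | h
    · exact h1 _ _ h
    · exact (h1 _ _ h).symm
  -- Image triangle and rotation are read off from any arc side, by `hpair` and `hrot` independently
  -- of the choice. Triangles without arc sides are left fixed.
  let g : G.Tri → G.Tri × Fin 3 := fun D =>
    if h : ∃ x, (G.arcSide x).1 = D then
      ((G.arcSide (Φ h.choose)).1, (G.arcSide (Φ h.choose)).2 - (G.arcSide h.choose).2)
    else (D, 0)
  have hg : ∀ x, g (G.arcSide x).1 =
      ((G.arcSide (Φ x)).1, (G.arcSide (Φ x)).2 - (G.arcSide x).2) := by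
    intro x
    have h : ∃ y, (G.arcSide y).1 = (G.arcSide x).1 := ⟨x, rfl⟩
    simp only [g, dif_pos h]
    exact Prod.ext ((hpair _ _).2 h.choose_spec) (hrot _ _ h.choose_spec)
  have hg' : ∀ D, (¬ ∃ x, (G.arcSide x).1 = D) → g D = (D, 0) := fun D h => dif_neg h
  -- Triangles with arc sides go to triangles with arc sides, so they never collide with the fixed
  -- ones. Finiteness turns injectivity into bijectivity.
  have hinj : Function.Injective fun D => (g D).1 := by
    intro D D' h
    change (g D).1 = (g D').1 at h
    by_cases hD : ∃ x, (G.arcSide x).1 = D <;> by_cases hD' : ∃ x, (G.arcSide x).1 = D'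
    · obtain ⟨x, rfl⟩ := hD
      obtain ⟨y, rfl⟩ := hD'
      rw [hg, hg] at h
      exact (hpair _ _).1 h
    · obtain ⟨x, rfl⟩ := hD
      rw [hg, hg' _ hD'] at h
      exact absurd ⟨_, h⟩ hD'
    · obtain ⟨x, rfl⟩ := hD'
      rw [hg, hg' _ hD] at h
      exact absurd ⟨_, h.symm⟩ hD
    · rwa [hg' _ hD, hg' _ hD'] at h
  refine ⟨⟨Equiv.ofBijective _ (Finite.injective_iff_bijective.1 hinj), fun D => (g D).2, π, Φ, hπ,
    fun x => ?_⟩, rfl, rfl⟩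
  rw [Equiv.ofBijective_apply, hg]
  simp

end TriangleGluing

/-! ### From quiver automorphisms to automorphisms of the pattern -/

namespace Triangulation

open TriangleGluing

variable {S : Type*} [TopologicalSpace S] [T2Space S] [CompactSpace S] [ConnectedSpace S]
  [ChartedSpace (EuclideanHalfSpace 2) S] {X : MarkedSurface S} {T : Triangulation X}

instance finite_arrow : Finite T.Arrow :=
  Finite.of_injective (fun a : T.Arrow => (a.tri, a.corner)) fun _ _ h =>
    arrow_ext (congrArg Prod.fst h) (congrArg Prod.snd h)

namespace Arrow

/-- The side of the triangle of an arrow at which the arrow starts. -/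
noncomputable def sourceSide (a : T.Arrow) : T.Arc ⊕ T.Arc :=
  (isSide_iff.1 a.isSide_source).choose

/-- The side of the triangle of an arrow at which the arrow ends. -/
noncomputable def targetSide (a : T.Arrow) : T.Arc ⊕ T.Arc :=
  (isSide_iff.1 a.isSide_target).choose

theorem arcSide_sourceSide (a : T.Arrow) : T.arcSide a.sourceSide = (a.tri, a.corner - 1) :=
  (isSide_iff.1 a.isSide_source).choose_spec.1

theorem arcOf_sourceSide (a : T.Arrow) : arcOf a.sourceSide = a.source :=
  (isSide_iff.1 a.isSide_source).choose_spec.2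

theorem arcSide_targetSide (a : T.Arrow) : T.arcSide a.targetSide = (a.tri, a.corner) :=
  (isSide_iff.1 a.isSide_target).choose_spec.1

theorem arcOf_targetSide (a : T.Arrow) : arcOf a.targetSide = a.target :=
  (isSide_iff.1 a.isSide_target).choose_spec.2

theorem sourceSide_injective : Function.Injective (sourceSide (T := T)) := fun a b h => by
  have := congrArg T.arcSide h
  rw [arcSide_sourceSide, arcSide_sourceSide, Prod.mk.injEq, sub_left_inj] at this
  exact arrow_ext this.1 this.2

theorem targetSide_injective : Function.Injective (targetSide (T := T)) := fun a b h => by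
  have := congrArg T.arcSide h
  rw [arcSide_targetSide, arcSide_targetSide, Prod.mk.injEq] at this
  exact arrow_ext this.1 this.2

theorem follows (a : T.Arrow) : Follows a.sourceSide a.targetSide := by
  rw [Follows, arcSide_sourceSide, arcSide_targetSide, sub_add_cancel]

/-- Together with `follows`, this identifies arrows with pairs of consecutive arc sides of a
triangle. -/
theorem exists_of_follows {x y : T.Arc ⊕ T.Arc} (h : Follows x y) :
    ∃ a : T.Arrow, a.sourceSide = x ∧ a.targetSide = y := by
  refine ⟨⟨(T.arcSide y).1, (T.arcSide y).2, arcOf x, arcOf y, isSide_iff.2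
      ⟨x, by rw [show T.arcSide y = _ from h, add_sub_cancel_right], rfl⟩,
    isSide_iff.2 ⟨y, rfl, rfl⟩⟩, arcSide_injective ?_, arcSide_injective ?_⟩
  · rw [arcSide_sourceSide]
    change ((T.arcSide y).1, (T.arcSide y).2 - 1) = _
    rw [show T.arcSide y = _ from h, add_sub_cancel_right]
  · rw [arcSide_targetSide]

/-- The target side of an arrow is the source side of another exactly if they form a relation of the
Jacobian algebra. -/
theorem targetSide_eq_sourceSide_iff {a b : T.Arrow} : a.targetSide = b.sourceSide ↔
    T.IsInternal a.tri ∧ b.tri = a.tri ∧ b.corner = a.corner + 1 := by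
  rw [← arcSide_injective.eq_iff, arcSide_targetSide, arcSide_sourceSide, Prod.mk.injEq]
  constructor
  · rintro ⟨ht, hc⟩
    refine ⟨fun c => ?_, ht.symm, by rw [hc, sub_add_cancel]⟩
    -- The three sides of the triangle are the source side of `a`, the target side of `a` and the
    -- target side of `b`, so all are arcs.
    have key : ∀ c d : Fin 3, c = d - 1 ∨ c = d ∨ c = d + 1 := by decide
    rcases key c a.corner with rfl | rfl | rfl
    · exact ⟨_, a.isSide_source⟩
    · exact ⟨_, a.isSide_target⟩
    · rw [hc, sub_add_cancel, ht]
      exact ⟨_, b.isSide_target⟩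
  · rintro ⟨_, ht, hc⟩
    exact ⟨ht.symm, by rw [hc, add_sub_cancel_right]⟩

theorem exists_sourceSide_eq {a : T.Arrow} (ha : T.IsInternal a.tri) :
    ∃ b : T.Arrow, a.targetSide = b.sourceSide := by
  obtain ⟨i, hi⟩ := ha (a.corner + 1)
  exact ⟨⟨a.tri, a.corner + 1, a.target, i, by simpa using a.isSide_target, hi⟩,
    targetSide_eq_sourceSide_iff.2 ⟨ha, rfl, rfl⟩⟩

end Arrow

open Arrow

/-- The automorphism `φ` of the quiver preserves the relations of the Jacobian algebra. -/
def QuiverAut.PreservesRelations (φ : T.QuiverAut) : Prop :=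
  ∀ a b : T.Arrow, a.targetSide = b.sourceSide →
    (φ.arrow a).targetSide = (φ.arrow b).sourceSide

namespace QuiverAut.PreservesRelations

variable {φ : T.QuiverAut} (hφ : φ.PreservesRelations)
include hφ

theorem isInternal {a : T.Arrow} (ha : T.IsInternal a.tri) : T.IsInternal (φ.arrow a).tri := by
  obtain ⟨b, hb⟩ := exists_sourceSide_eq ha
  exact (targetSide_eq_sourceSide_iff.1 (hφ a b hb)).1

/-- The converse is a counting argument: `φ` maps the finite set of arrows of internal triangles
injectively, hence bijectively, to itself. -/
theorem isInternal_iff {a : T.Arrow} : T.IsInternal (φ.arrow a).tri ↔ T.IsInternal a.tri := by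
  refine ⟨fun h => ?_, hφ.isInternal⟩
  let g : {a : T.Arrow // T.IsInternal a.tri} → {a : T.Arrow // T.IsInternal a.tri} :=
    fun a => ⟨φ.arrow a.1, hφ.isInternal a.2⟩
  have hg : Function.Injective g := fun a b hab =>
    Subtype.ext (φ.arrow.injective (congrArg Subtype.val hab))
  obtain ⟨b, hb⟩ := (Finite.injective_iff_surjective.1 hg) ⟨φ.arrow a, h⟩
  rw [← φ.arrow.injective (congrArg Subtype.val hb)]
  exact b.2

/-- If the images form a relation, then `a` lies in an internal triangle and has a successor `b'`
there. Both `φ b'` and `φ b` start at the target side of `φ a`, so `b' = b`. -/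
theorem iff (a b : T.Arrow) :
    (φ.arrow a).targetSide = (φ.arrow b).sourceSide ↔ a.targetSide = b.sourceSide := by
  refine ⟨fun h => ?_, hφ a b⟩
  obtain ⟨b', hb'⟩ := exists_sourceSide_eq
    (hφ.isInternal_iff.1 (targetSide_eq_sourceSide_iff.1 h).1)
  rw [hb', φ.arrow.injective (sourceSide_injective ((hφ a b' hb').symm.trans h))]

open Classical in
/-- There is a permutation of the sides of the arcs that maps the sides of the triangle of each
arrow `a` to the sides of the triangle of `φ a`. -/
theorem exists_perm : ∃ Φ : Equiv.Perm (T.Arc ⊕ T.Arc), (∀ x, arcOf (Φ x) = φ.vertex (arcOf x)) ∧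
    ∀ a : T.Arrow, Φ a.sourceSide = (φ.arrow a).sourceSide ∧
      Φ a.targetSide = (φ.arrow a).targetSide := by
  -- `R` is the matching of sides forced by the arrows. A side can be the source side of one arrow
  -- and the target side of another exactly at a relation, so preservation of relations in both
  -- directions makes `R` a partial injection.
  let R : T.Arc ⊕ T.Arc → T.Arc ⊕ T.Arc → Prop := fun x y => ∃ a : T.Arrow,
    (a.sourceSide = x ∧ (φ.arrow a).sourceSide = y) ∨
      (a.targetSide = x ∧ (φ.arrow a).targetSide = y)
  have hRinj : ∀ x x' y, R x y → R x' y → x = x' := by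
    rintro x x' y ⟨a, ⟨rfl, h⟩ | ⟨rfl, h⟩⟩ ⟨b, ⟨rfl, h'⟩ | ⟨rfl, h'⟩⟩
    · rw [φ.arrow.injective (sourceSide_injective (h.trans h'.symm))]
    · exact ((hφ.iff b a).1 (h'.trans h.symm)).symm
    · exact (hφ.iff a b).1 (h.trans h'.symm)
    · rw [φ.arrow.injective (targetSide_injective (h.trans h'.symm))]
  have hRfun : ∀ x y y', R x y → R x y' → y = y' := by
    rintro x y y' ⟨a, ⟨h, rfl⟩ | ⟨h, rfl⟩⟩ ⟨b, ⟨h', rfl⟩ | ⟨h', rfl⟩⟩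
    · rw [sourceSide_injective (h.trans h'.symm)]
    · exact ((hφ.iff b a).2 (h'.trans h.symm)).symm
    · exact (hφ.iff a b).2 (h.trans h'.symm)
    · rw [targetSide_injective (h.trans h'.symm)]
  have hRarc : ∀ x y, R x y → arcOf y = φ.vertex (arcOf x) := by
    rintro x y ⟨a, ⟨rfl, rfl⟩ | ⟨rfl, rfl⟩⟩
    · rw [arcOf_sourceSide, arcOf_sourceSide, φ.source_arrow]
    · rw [arcOf_targetSide, arcOf_targetSide, φ.target_arrow]
  let F : T.Arc ⊕ T.Arc → T.Arc ⊕ T.Arc := Sum.map φ.vertex φ.vertex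
  have hFarc : ∀ x, arcOf (F x) = φ.vertex (arcOf x) := by rintro (i | i) <;> rfl
  have hFswap : ∀ x, F x.swap = (F x).swap := by rintro (i | i) <;> rfl
  have hFinj : Function.Injective F := φ.vertex.injective.sumMap φ.vertex.injective
  have hR : ∀ x y, R x y → y = F x ∨ y = (F x).swap := fun x y h =>
    eq_or_eq_swap (by rw [hRarc _ _ h, hFarc])
  -- The forced matching either keeps or exchanges left and right at an arc, never both. The same
  -- choice then serves for sides belonging to no arrow.
  have hflip : ∀ i, ∃ b : Bool, ∀ x y, arcOf x = i → R x y →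
      y = if b then (F x).swap else F x := by
    intro i
    by_cases h : ∃ x, arcOf x = i ∧ R x (F x)
    · obtain ⟨x, rfl, hx⟩ := h
      refine ⟨false, fun x' y hx' hy => ?_⟩
      rcases eq_or_eq_swap hx'.symm with rfl | rfl
      · exact hRfun _ _ _ hy hx
      · rcases hR _ _ hy with rfl | rfl
        · rfl
        · rw [hFswap, Sum.swap_swap] at hy
          exact absurd (hRinj _ _ _ hy hx) (swap_ne x)
    · refine ⟨true, fun x y hx hy => (hR _ _ hy).resolve_left ?_⟩
      rintro rfl
      exact h ⟨x, hx, hy⟩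
  choose b hb using hflip
  let Φ : T.Arc ⊕ T.Arc → T.Arc ⊕ T.Arc := fun x => if b (arcOf x) then (F x).swap else F x
  have hΦarc : ∀ x, arcOf (Φ x) = φ.vertex (arcOf x) := by
    intro x
    by_cases h : b (arcOf x) <;> simp [Φ, h, hFarc]
  have hΦinj : Function.Injective Φ := by
    intro x y hxy
    have harc : arcOf x = arcOf y := φ.vertex.injective (by rw [← hΦarc, hxy, hΦarc])
    by_cases h : b (arcOf y)
    · simp only [Φ, harc, h, if_true] at hxy
      exact hFinj (Sum.swap_leftInverse.injective hxy)
    · simp only [Φ, harc, h] at hxy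
      exact hFinj hxy
  refine ⟨Equiv.ofBijective Φ (Finite.injective_iff_bijective.1 hΦinj), hΦarc, fun a => ⟨?_, ?_⟩⟩
  · exact (hb _ _ _ rfl ⟨a, Or.inl ⟨rfl, rfl⟩⟩).symm
  · exact (hb _ _ _ rfl ⟨a, Or.inr ⟨rfl, rfl⟩⟩).symm

/-- An automorphism of the quiver that preserves the relations comes from an automorphism of the
combinatorial pattern of the triangulation. -/
theorem exists_automorphism : ∃ A : T.toTriangleGluing.Automorphism, A.arc = φ.vertex ∧
    ∀ a : T.Arrow, (φ.arrow a).tri = A.tri a.tri ∧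
      (φ.arrow a).corner = a.corner + A.rot a.tri := by
  obtain ⟨Φ, hΦarc, hΦ⟩ := hφ.exists_perm
  obtain ⟨A, hA, rfl⟩ := TriangleGluing.exists_automorphism φ.vertex Φ hΦarc fun x y => by
    constructor
    · intro h
      obtain ⟨a', hx, hy⟩ := exists_of_follows h
      obtain ⟨a, rfl⟩ := φ.arrow.surjective a'
      rw [← (hΦ a).1] at hx
      rw [← (hΦ a).2] at hy
      rw [← Φ.injective hx, ← Φ.injective hy]
      exact a.follows
    · intro h
      obtain ⟨a, rfl, rfl⟩ := exists_of_follows h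
      rw [(hΦ a).1, (hΦ a).2]
      exact (φ.arrow a).follows
  refine ⟨A, hA, fun a => ?_⟩
  have h := A.arcSide_side a.targetSide
  rw [(hΦ a).2, arcSide_targetSide, arcSide_targetSide] at h
  exact ⟨congrArg Prod.fst h, congrArg Prod.snd h⟩

end QuiverAut.PreservesRelations

/-- An automorphism of the quiver induced by an endomorphism of the Jacobian algebra preserves the
relations. -/
theorem AlgHomInduces.preservesRelations {k : Type*} [Field k]
    {f : T.JacobianAlgebra k →ₐ[k] T.JacobianAlgebra k} {φ : T.QuiverAut}
    (hf : AlgHomInduces f φ) : φ.PreservesRelations := fun a b h => by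
  obtain ⟨hint, htri, hcorner⟩ := targetSide_eq_sourceSide_iff.1 h
  exact targetSide_eq_sourceSide_iff.2 (hf.relation hint htri hcorner)

end Triangulation

/-! ### Rotations of the model triangle -/

theorem triVertex_eq_pow (c : Fin 3) :
    triVertex c = Complex.exp (2 * Real.pi * Complex.I / 3) ^ (c : ℕ) := by
  rw [triVertex, ← Complex.exp_nat_mul]
  congr 1
  ring

theorem exp_third_pow_three : Complex.exp (2 * Real.pi * Complex.I / 3) ^ 3 = 1 := by
  rw [← Complex.exp_nat_mul, ← Complex.exp_two_pi_mul_I]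
  congr 1
  push_cast
  ring

theorem triVertex_mul (c d : Fin 3) : triVertex c * triVertex d = triVertex (d + c) := by
  rw [triVertex_eq_pow, triVertex_eq_pow, triVertex_eq_pow, ← pow_add, Fin.val_add, add_comm]
  exact pow_eq_pow_mod _ exp_third_pow_three

theorem triVertex_zero : triVertex 0 = 1 := by simp [triVertex_eq_pow]

theorem triVertex_eq_circleExp (c : Fin 3) :
    triVertex c = Circle.exp (2 * Real.pi * ((c : ℕ) : ℝ) / 3) := by
  rw [triVertex, Circle.coe_exp]
  congr 1
  push_cast
  ring

theorem triVertex_mul_mem {z : ℂ} (c : Fin 3) (hz : z ∈ StdTriangle) :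
    triVertex c * z ∈ StdTriangle := by
  have h := (LinearMap.mulLeft ℝ (triVertex c)).image_convexHull (Set.range triVertex)
  have h1 : triVertex c * z ∈ (LinearMap.mulLeft ℝ (triVertex c)) '' StdTriangle := ⟨z, hz, rfl⟩
  rw [StdTriangle, h] at h1
  refine convexHull_mono ?_ h1
  rintro _ ⟨_, ⟨d, rfl⟩, rfl⟩
  exact ⟨d + c, (triVertex_mul c d).symm⟩

/-- The rotation of the model triangle that maps the `d`-th corner to the corner `d + c`. -/
noncomputable def rotateTriangle (c : Fin 3) (z : StdTriangle) : StdTriangle :=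
  ⟨triVertex c * z, triVertex_mul_mem c z.2⟩

theorem continuous_rotateTriangle (c : Fin 3) : Continuous (rotateTriangle c) := by
  unfold rotateTriangle
  fun_prop

theorem rotateTriangle_rotateTriangle (c d : Fin 3) (z : StdTriangle) :
    rotateTriangle c (rotateTriangle d z) = rotateTriangle (d + c) z :=
  Subtype.ext (by simp only [rotateTriangle]; rw [← mul_assoc, triVertex_mul])

theorem rotateTriangle_zero (z : StdTriangle) : rotateTriangle 0 z = z :=
  Subtype.ext (by simp [rotateTriangle, triVertex_zero])

theorem rotateTriangle_cornerPoint (c d : Fin 3) :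
    rotateTriangle c (cornerPoint d) = cornerPoint (d + c) :=
  Subtype.ext (triVertex_mul c d)

theorem rotateTriangle_sidePoint (c d : Fin 3) (t : I) :
    rotateTriangle c (sidePoint d t) = sidePoint (d + c) t := by
  refine Subtype.ext ?_
  simp only [rotateTriangle, sidePoint]
  rw [mul_add, mul_smul_comm, mul_smul_comm, triVertex_mul, triVertex_mul, add_right_comm]

instance compactSpace_stdTriangle : CompactSpace StdTriangle :=
  isCompact_iff_compactSpace.1 ((Set.finite_range triVertex).isCompact_convexHull ℝ)

theorem interior_stdTriangle_nonempty : (interior StdTriangle).Nonempty := by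
  have hexp : Complex.exp (2 * Real.pi * Complex.I / 3) = ⟨-1 / 2, √3 / 2⟩ := by
    have e : (2 * Real.pi * Complex.I / 3 : ℂ) = ((Real.pi - Real.pi / 3 : ℝ) : ℂ) * Complex.I := by
      push_cast; ring
    rw [e]
    apply Complex.ext
    · rw [Complex.exp_ofReal_mul_I_re, Real.cos_pi_sub, Real.cos_pi_div_three]
      norm_num
    · rw [Complex.exp_ofReal_mul_I_im, Real.sin_pi_sub, Real.sin_pi_div_three]
  have h3 : √3 * √3 = 3 := Real.mul_self_sqrt (by norm_num)
  have h1 : triVertex 1 = ⟨-1 / 2, √3 / 2⟩ := by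
    rw [triVertex_eq_pow, hexp]
    exact pow_one _
  have h2 : triVertex 2 = ⟨-1 / 2, -(√3 / 2)⟩ := by
    rw [triVertex_eq_pow, hexp]
    change _ ^ 2 = _
    rw [pow_two]
    apply Complex.ext
    · rw [Complex.mul_re]; dsimp only; linarith
    · rw [Complex.mul_im]; dsimp only; linarith
  have hs1 : 1 ≤ √3 := Real.one_le_sqrt.2 (by norm_num)
  -- For `‖z‖ < 1/6` the barycentric coordinates `w` below are non-negative, since `√3 ≤ 2`.
  refine ⟨0, mem_interior_iff_mem_nhds.2 (Metric.mem_nhds_iff.2 ⟨1 / 6, by norm_num, ?_⟩)⟩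
  intro z hz
  rw [mem_ball_zero_iff] at hz
  have hre := abs_le.1 ((Complex.abs_re_le_norm z).trans hz.le)
  have him := abs_le.1 ((Complex.abs_im_le_norm z).trans hz.le)
  let w : Fin 3 → ℝ := ![1 / 3 + 2 * z.re / 3, 1 / 3 - z.re / 3 + √3 * z.im / 3,
    1 / 3 - z.re / 3 - √3 * z.im / 3]
  have hs2 : √3 ≤ 2 := by nlinarith
  have hw : ∀ c, 0 ≤ w c := by
    intro c
    have e1 : √3 * z.im ≤ 1 / 3 := by nlinarith
    have e2 : -(1 / 3) ≤ √3 * z.im := by nlinarith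
    fin_cases c <;> simp [w] <;> linarith
  have hw1 : ∑ c, w c = 1 := by
    simp [Fin.sum_univ_three, w]; ring
  have hz' : z = ∑ c, w c • triVertex c := by
    rw [Fin.sum_univ_three, triVertex_zero, h1, h2]
    apply Complex.ext
    · simp [w]; ring
    · simp [w]; linear_combination (-z.im / 3) * h3
  rw [hz']
  exact (convex_convexHull ℝ _).sum_mem (fun c _ => hw c) hw1
    fun c _ => subset_convexHull ℝ _ (Set.mem_range_self c)

/-- Every non-empty open subset of the model triangle contains a round disc. -/
theorem exists_disc_subset {U : Set StdTriangle} (hU : IsOpen U) (hne : U.Nonempty) :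
    ∃ (a : ℂ) (ρ : ℝ), 0 < ρ ∧ ∃ h : ∀ z : 𝔻, a + ρ * (z : ℂ) ∈ StdTriangle,
      ∀ z : 𝔻, (⟨a + ρ * (z : ℂ), h z⟩ : StdTriangle) ∈ U := by
  obtain ⟨V, hV, rfl⟩ := isOpen_induced_iff.1 hU
  obtain ⟨⟨x, hx⟩, hxV⟩ := hne
  have hcl : x ∈ closure (interior StdTriangle) := by
    have h := (convex_convexHull ℝ _).closure_interior_eq_closure_of_nonempty_interior
      interior_stdTriangle_nonempty
    exact h.symm ▸ subset_closure hx
  obtain ⟨a, haV, ha⟩ := mem_closure_iff.1 hcl V hV hxV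
  obtain ⟨ρ, hρ, hball⟩ := Metric.isOpen_iff.1 (hV.inter isOpen_interior) a ⟨haV, ha⟩
  have hmem : ∀ z : 𝔻, a + ρ * (z : ℂ) ∈ V ∩ interior StdTriangle := by
    intro z
    refine hball ?_
    rw [Metric.mem_ball, dist_eq_norm, add_sub_cancel_left, norm_mul, Complex.norm_real,
      Real.norm_of_nonneg hρ.le]
    exact mul_lt_of_lt_one_right hρ z.norm_lt_one
  exact ⟨a, ρ, hρ, fun z => interior_subset (hmem z).2, fun z => (hmem z).1⟩

/-! ### Orientation-preserving embeddings of the disc -/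

theorem isOpenEmbedding_circle_smul (u : Circle) :
    Topology.IsOpenEmbedding fun z : 𝔻 => u • z := by
  have hc : ∀ u : Circle, Continuous fun z : 𝔻 => u • z := fun u => by
    rw [Complex.UnitDisc.isEmbedding_coe.continuous_iff]
    have h : Continuous fun z : 𝔻 => (u : ℂ) * (z : ℂ) :=
      continuous_const.mul Complex.UnitDisc.continuous_coe
    exact h
  exact (Homeomorph.mk (MulAction.toPerm u) (hc u) (hc u⁻¹)).isOpenEmbedding

theorem discOrientationPreserving_smul (u : Circle) :
    DiscOrientationPreserving (fun z => u • z) := by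
  intro z hz
  refine ⟨fun t => t + Complex.arg (u * z), by fun_prop, fun t => ?_, by ring⟩
  have h0 : ((u • (0 : 𝔻) : 𝔻) : ℂ) = 0 := by simp
  have hn : ‖((u • Circle.exp t • z : 𝔻) : ℂ)‖ = ‖(u * z : ℂ)‖ := by simp
  have harg := Complex.norm_mul_exp_arg_mul_I (u * z)
  have h1 : ((u • Circle.exp t • z : 𝔻) : ℂ) = Circle.exp t * (u * z) := by
    simp only [Complex.UnitDisc.coe_circle_smul]; ring
  beta_reduce
  rw [h0, sub_zero, hn, h1]
  nth_rewrite 1 [← harg]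
  rw [Circle.exp_add, Circle.coe_mul, Circle.coe_exp (Complex.arg _)]
  ring

/-- Conjugate vectors have a positive product, so the two arguments add up to a multiple of `2π` at
all times. Their sum would nevertheless grow by `4π`, passing continuously through an odd multiple
of `π`. -/
theorem not_discOrientationPreserving_star {g : 𝔻 → 𝔻} (hg : Function.Injective g)
    (h : DiscOrientationPreserving g) : ¬ DiscOrientationPreserving (fun z => star (g z)) := by
  intro h'
  obtain ⟨z, hz⟩ : ∃ z : 𝔻, z ≠ 0 :=
    ⟨Complex.UnitDisc.mk (1 / 2) (by norm_num), fun h => by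
      have := congrArg (fun z : 𝔻 => (z : ℂ)) h
      norm_num at this⟩
  obtain ⟨θ, hθ, hθg, hθ2⟩ := h z hz
  obtain ⟨η, hη, hηg, hη2⟩ := h' z hz
  have hone : ∀ t, (Circle.exp (θ t + η t) : ℂ) = 1 := by
    intro t
    have hne : (g (Circle.exp t • z) : ℂ) - (g 0 : ℂ) ≠ 0 := by
      intro h0
      have h1 : Circle.exp t • z = 0 :=
        hg (Complex.UnitDisc.coe_injective (sub_eq_zero.1 h0))
      refine hz (Complex.UnitDisc.coe_injective ?_)
      have h2 := congrArg (fun z : 𝔻 => (z : ℂ)) h1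
      simpa using h2
    have h1 := hθg t
    have h2 := hηg t
    simp only [Complex.UnitDisc.coe_star] at h2
    rw [← map_sub, RCLike.norm_conj] at h2
    have h3 := Complex.mul_conj' ((g (Circle.exp t • z) : ℂ) - (g 0 : ℂ))
    rw [h2] at h3
    nth_rewrite 1 [h1] at h3
    rw [Circle.exp_add, Circle.coe_mul]
    have h4 : ((‖(g (Circle.exp t • z) : ℂ) - (g 0 : ℂ)‖ : ℂ)) ^ 2 ≠ 0 :=
      pow_ne_zero _ (by simpa using hne)
    refine mul_left_cancel₀ h4 ?_
    rw [mul_one]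
    nth_rewrite 2 [← h3]
    ring
  have hpi := Real.pi_pos
  obtain ⟨t, -, ht⟩ := intermediate_value_Icc (f := fun t => θ t + η t)
    (show (0 : ℝ) ≤ 2 * Real.pi by positivity) (hθ.add hη).continuousOn
    (show θ 0 + η 0 + Real.pi ∈ _ from ⟨by linarith, by linarith⟩)
  have h1 := hone t
  have h0 := hone 0
  beta_reduce at ht
  rw [ht, Circle.exp_add, Circle.coe_mul, h0, one_mul, Circle.coe_exp, Complex.exp_pi_mul_I] at h1
  norm_num at h1

/-- Orientation can be tested on one positive subdisc: if `ψ` were not positive, its mirror image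
would be, and both `g` and its conjugate would preserve orientation. -/
theorem SurfaceOrientation.mem_pos_iff {S : Type*} [TopologicalSpace S] (o : SurfaceOrientation S)
    {ψ : 𝔻 → S} (hψ : Topology.IsOpenEmbedding ψ) {g : 𝔻 → 𝔻} (hg : ψ ∘ g ∈ o.pos) :
    ψ ∈ o.pos ↔ DiscOrientationPreserving g := by
  have hgo : Topology.IsOpenEmbedding g :=
    (Topology.IsOpenEmbedding.of_comp_iff g hψ).1 (o.isOpenEmbedding _ hg)
  refine ⟨fun h => (o.subdisc ψ h g hgo).1 hg, fun h => ?_⟩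
  refine (o.pos_or_mirror ψ hψ).resolve_right fun hm => ?_
  have hcomp : (fun z => ψ (star z)) ∘ (fun z => star (g z)) = ψ ∘ g := by
    funext z
    simp
  have hgs : Topology.IsOpenEmbedding fun z => star (g z) :=
    (Topology.IsOpenEmbedding.of_comp_iff _ (o.isOpenEmbedding _ hm)).1
      (by rw [hcomp]; exact o.isOpenEmbedding _ hg)
  exact not_discOrientationPreserving_star hgo.injective h
    ((o.subdisc _ hm _ hgs).1 (by rw [hcomp]; exact hg))

/-! ### Realization by a homeomorphism of the surface -/

namespace TriangleGluing.Automorphism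

variable {G : TriangleGluing} (A : G.Automorphism)

/-- The inverse automorphism. -/
def symm : G.Automorphism where
  tri := A.tri.symm
  rot D := -A.rot (A.tri.symm D)
  arc := A.arc.symm
  side := A.side.symm
  arcOf_side x := by
    rw [Equiv.eq_symm_apply, ← A.arcOf_side, Equiv.apply_symm_apply]
  arcSide_side x := by
    obtain ⟨y, rfl⟩ := A.side.surjective x
    rw [Equiv.symm_apply_apply, A.arcSide_side]
    simp

end TriangleGluing.Automorphism

namespace Triangulation

open TriangleGluing

variable {S : Type*} [TopologicalSpace S] [T2Space S] [CompactSpace S] [ConnectedSpace S]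
  [ChartedSpace (EuclideanHalfSpace 2) S] {X : MarkedSurface S} (T : Triangulation X)

theorem chart_sidePoint_swap (x : T.Arc ⊕ T.Arc) (t : I) :
    T.chart (T.arcSide x.swap).1 (sidePoint (T.arcSide x.swap).2 (σ t)) =
      T.chart (T.arcSide x).1 (sidePoint (T.arcSide x).2 t) := by
  have h : ∀ i t, T.chart (T.left i).1 (sidePoint (T.left i).2 t) =
      T.chart (T.right i).1 (sidePoint (T.right i).2 (σ t)) := fun i t =>
    (T.chart_eq_iff ((T.left i).1, _) ((T.right i).1, _)).2 (Relation.EqvGen.rel _ _ (.along i t))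
  rcases x with i | i
  · exact (h i t).symm
  · have := h i (σ t)
    rwa [unitInterval.symm_symm] at this

/-- The union of the characteristic maps. -/
def totalChart (p : (_ : T.Tri) × StdTriangle) : S := T.chart p.1 p.2

/-- A continuous surjection from a compact space, here finitely many triangles, onto a Hausdorff
space is closed. -/
theorem isQuotientMap_totalChart : Topology.IsQuotientMap T.totalChart := by
  have hc : Continuous T.totalChart := continuous_sigma T.continuous_chart
  refine hc.isClosedMap.isQuotientMap hc fun x => ?_
  obtain ⟨D, z, h⟩ := T.covers x
  exact ⟨⟨D, z⟩, h⟩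

variable {T} (A : T.toTriangleGluing.Automorphism)

/-- Coincidences of charts are generated by the gluings along arcs, and the automorphism sends the
two sides of an arc to the two sides of another. -/
theorem chart_automorphism_congr {p q : T.Tri × StdTriangle}
    (h : T.chart p.1 p.2 = T.chart q.1 q.2) :
    T.chart (A.tri p.1) (rotateTriangle (A.rot p.1) p.2) =
      T.chart (A.tri q.1) (rotateTriangle (A.rot q.1) q.2) := by
  rw [T.chart_eq_iff] at h
  induction h with
  | rel p q h =>
    obtain ⟨i, t⟩ := h
    have key : ∀ x t, T.chart (A.tri (T.arcSide x).1)
        (rotateTriangle (A.rot (T.arcSide x).1) (sidePoint (T.arcSide x).2 t)) =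
          T.chart (T.arcSide (A.side x)).1 (sidePoint (T.arcSide (A.side x)).2 t) := by
      intro x t
      rw [rotateTriangle_sidePoint, A.arcSide_side]
    refine (key (Sum.inl i) t).trans (Eq.trans ?_ (key (Sum.inr i) (σ t)).symm)
    rw [← chart_sidePoint_swap, ← A.side_swap]
    rfl
  | refl => rfl
  | symm _ _ _ ih => exact ih.symm
  | trans _ _ _ _ _ ih ih' => exact ih.trans ih'

/-- The map of the surface given by an automorphism of the combinatorial pattern of the
triangulation. -/
noncomputable def realizeMap (x : S) : S :=
  T.chart (A.tri (T.covers x).choose)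
    (rotateTriangle (A.rot (T.covers x).choose) (T.covers x).choose_spec.choose)

theorem realizeMap_chart (D : T.Tri) (z : StdTriangle) :
    realizeMap A (T.chart D z) = T.chart (A.tri D) (rotateTriangle (A.rot D) z) :=
  chart_automorphism_congr A (p := ⟨_, _⟩) (q := (D, z))
    (T.covers (T.chart D z)).choose_spec.choose_spec

theorem continuous_realizeMap : Continuous (realizeMap A) := by
  rw [T.isQuotientMap_totalChart.continuous_iff]
  refine continuous_sigma fun D => ?_
  have h : (fun z => (realizeMap A ∘ T.totalChart) ⟨D, z⟩) =
      fun z => T.chart (A.tri D) (rotateTriangle (A.rot D) z) :=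
    funext fun z => realizeMap_chart A D z
  rw [h]
  exact (T.continuous_chart _).comp (continuous_rotateTriangle _)

/-- The homeomorphism of the surface given by an automorphism of the combinatorial pattern of the
triangulation. -/
noncomputable def realize : S ≃ₜ S where
  toFun := realizeMap A
  invFun := realizeMap A.symm
  left_inv x := by
    obtain ⟨D, z, rfl⟩ := T.covers x
    rw [realizeMap_chart, realizeMap_chart, rotateTriangle_rotateTriangle]
    simp [Automorphism.symm, rotateTriangle_zero]
  right_inv x := by
    obtain ⟨D, z, rfl⟩ := T.covers x
    rw [realizeMap_chart, realizeMap_chart, rotateTriangle_rotateTriangle]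
    simp [Automorphism.symm, rotateTriangle_zero]
  continuous_toFun := continuous_realizeMap A
  continuous_invFun := continuous_realizeMap A.symm

theorem realize_chart (D : T.Tri) (z : StdTriangle) :
    realize A (T.chart D z) = T.chart (A.tri D) (rotateTriangle (A.rot D) z) :=
  realizeMap_chart A D z

/-- Some round disc of a triangle lies in the image of `ψ`, where it is a subdisc `ψ ∘ g`. Its image
is a round disc of another triangle, precomposed with a rotation, hence positive. So `g` decides the
orientation of both `ψ` and its image. -/
theorem realize_comp_mem_pos {ψ : 𝔻 → S} (hψ : ψ ∈ X.orientation.pos) :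
    realize A ∘ ψ ∈ X.orientation.pos := by
  have hψo := X.orientation.isOpenEmbedding ψ hψ
  obtain ⟨D, z₀, hz₀⟩ := T.covers (ψ 0)
  obtain ⟨a, ρ, hρ, hmem, hU⟩ := exists_disc_subset
    (hψo.isOpen_range.preimage (T.continuous_chart D)) ⟨z₀, 0, hz₀.symm⟩
  choose g hg using hU
  have hχ := T.positive D a ρ hρ hmem
  have hψg : ψ ∘ g ∈ X.orientation.pos := by
    have : ψ ∘ g = _ := funext hg
    rwa [this]
  refine (X.orientation.mem_pos_iff ((realize A).isOpenEmbedding.comp hψo) (g := g) ?_).2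
    ((X.orientation.mem_pos_iff hψo hψg).1 hψ)
  set u := Circle.exp (2 * Real.pi * ((A.rot D : ℕ) : ℝ) / 3) with hu
  have hu' : triVertex (A.rot D) = u := triVertex_eq_circleExp _
  -- Rotation by `u` moves the centre `a` to `u a` and keeps the radius; the parametrization changes
  -- by `z ↦ u • z`.
  have hmem' : ∀ z : 𝔻, u * a + ρ * (z : ℂ) ∈ StdTriangle := by
    intro z
    have h := triVertex_mul_mem (A.rot D) (hmem (u⁻¹ • z))
    have e : triVertex (A.rot D) * (a + ρ * ((u⁻¹ • z : 𝔻) : ℂ)) = u * a + ρ * (z : ℂ) := by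
      rw [hu', Complex.UnitDisc.coe_circle_smul, Circle.coe_inv]
      have := u.coe_ne_zero
      field_simp
    rwa [e] at h
  have hχ' := T.positive (A.tri D) (u * a) ρ hρ hmem'
  have hsm : Topology.IsOpenEmbedding fun z : 𝔻 => u • z := isOpenEmbedding_circle_smul u
  have h := (X.orientation.subdisc _ hχ' _ hsm).2 (discOrientationPreserving_smul u)
  convert h using 1
  funext z
  simp only [Function.comp_apply]
  rw [hg z, realize_chart]
  congr 1
  refine Subtype.ext ?_
  simp only [rotateTriangle, Complex.UnitDisc.coe_circle_smul]
  rw [hu']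
  ring

theorem realize_mem_homeoPlus : realize A ∈ X.HomeoPlus := by
  have hmark : ∀ (A : T.toTriangleGluing.Automorphism) x,
      x ∈ X.marked → realize A x ∈ X.marked := by
    intro A x hx
    obtain ⟨D, c, rfl⟩ := (T.marked_iff x).1 hx
    rw [realize_chart, rotateTriangle_cornerPoint]
    exact (T.marked_iff _).2 ⟨_, _, rfl⟩
  have hinv : ∀ x, realize A.symm (realize A x) = x := (realize A).symm_apply_apply
  refine ⟨fun ψ => ⟨fun h => ?_, realize_comp_mem_pos A⟩, fun x => ⟨fun h => ?_, hmark A x⟩⟩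
  · have := realize_comp_mem_pos A.symm h
    have e : realize A.symm ∘ (realize A ∘ ψ) = ψ := funext fun z => hinv _
    rwa [e] at this
  · have := hmark A.symm _ h
    rwa [hinv] at this

theorem arcSet_eq_range (x : T.Arc ⊕ T.Arc) : T.arcSet (arcOf x) =
    Set.range fun t : I => T.chart (T.arcSide x).1 (sidePoint (T.arcSide x).2 t) := by
  rcases x with i | i
  · rfl
  · ext p
    constructor
    · rintro ⟨t, rfl⟩
      exact ⟨σ t, T.chart_sidePoint_swap (Sum.inl i) t⟩
    · rintro ⟨t, rfl⟩
      exact ⟨σ t, T.chart_sidePoint_swap (Sum.inr i) t⟩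

theorem realize_image_arcSet (i : T.Arc) : realize A '' T.arcSet i = T.arcSet (A.arc i) := by
  have h : A.arc i = arcOf (A.side (Sum.inl i)) := (A.arcOf_side (Sum.inl i)).symm
  rw [h, arcSet_eq_range, show i = arcOf (Sum.inl i) from rfl, arcSet_eq_range, ← Set.range_comp]
  congr 1
  funext t
  simp only [Function.comp_apply]
  rw [realize_chart, rotateTriangle_sidePoint, ← show arcOf (Sum.inl i) = i from rfl,
    A.arcSide_side]
  rfl

theorem realize_image_triSet (D : T.Tri) : realize A '' T.triSet D = T.triSet (A.tri D) := by
  ext p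
  constructor
  · rintro ⟨_, ⟨z, rfl⟩, rfl⟩
    rw [realize_chart]
    exact ⟨_, rfl⟩
  · rintro ⟨z, rfl⟩
    refine ⟨_, ⟨rotateTriangle (-A.rot D) z, rfl⟩, ?_⟩
    rw [realize_chart, rotateTriangle_rotateTriangle, neg_add_cancel, rotateTriangle_zero]

end Triangulation

/-! ### Endpoints of sides and images of cuts -/

theorem sidePoint_zero (c : Fin 3) : sidePoint c 0 = cornerPoint c :=
  Subtype.ext (by simp [sidePoint, cornerPoint])

theorem sidePoint_one (c : Fin 3) : sidePoint c 1 = cornerPoint (c + 1) :=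
  Subtype.ext (by simp [sidePoint, cornerPoint])

namespace TriangleGluing.Automorphism

variable {G : TriangleGluing} (A : G.Automorphism)

theorem isInternal {D : G.Tri} (hD : G.IsInternal D) : G.IsInternal (A.tri D) := by
  intro c
  obtain ⟨i, hi⟩ := hD (c - A.rot D)
  obtain ⟨x, hx, -⟩ := isSide_iff.1 hi
  refine ⟨_, isSide_iff.2 ⟨A.side x, ?_, rfl⟩⟩
  rw [A.arcSide_side, hx, sub_add_cancel]

theorem isInternal_iff {D : G.Tri} : G.IsInternal (A.tri D) ↔ G.IsInternal D := by
  refine ⟨fun h => ?_, A.isInternal⟩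
  have := A.symm.isInternal h
  rwa [show A.symm.tri (A.tri D) = D from A.tri.symm_apply_apply D] at this

end TriangleGluing.Automorphism

namespace Triangulation

open TriangleGluing Arrow

variable {S : Type*} [TopologicalSpace S] [T2Space S] [CompactSpace S] [ConnectedSpace S]
  [ChartedSpace (EuclideanHalfSpace 2) S] {X : MarkedSurface S} {T : Triangulation X}

/-- The image of an admissible cut under an automorphism of the combinatorial pattern. -/
def AdmissibleCut.map (A : T.toTriangleGluing.Automorphism) (χ : T.AdmissibleCut) :
    T.AdmissibleCut := fun D =>
  χ ⟨A.symm.tri D.1, A.symm.isInternal D.2⟩ + A.rot (A.symm.tri D.1)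

theorem AdmissibleCut.map_apply (A : T.toTriangleGluing.Automorphism) (χ : T.AdmissibleCut)
    {D : T.Tri} (hD : T.IsInternal D) (hD' : T.IsInternal (A.tri D)) :
    χ.map A ⟨A.tri D, hD'⟩ = χ ⟨D, hD⟩ + A.rot D := by
  have key : ∀ E, E = D → ∀ hE : T.IsInternal E, χ ⟨E, hE⟩ + A.rot E = χ ⟨D, hD⟩ + A.rot D := by
    rintro E rfl hE
    rfl
  exact key _ (A.tri.symm_apply_apply D) _

theorem AdmissibleCut.mem_arrows_map {A : T.toTriangleGluing.Automorphism} {φ : T.QuiverAut}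
    (hA : ∀ a : T.Arrow, (φ.arrow a).tri = A.tri a.tri ∧
      (φ.arrow a).corner = a.corner + A.rot a.tri) (χ : T.AdmissibleCut) (a : T.Arrow) :
    φ.arrow a ∈ (χ.map A).arrows ↔ a ∈ χ.arrows := by
  obtain ⟨htri, hcorner⟩ := hA a
  have key : ∀ D, D = A.tri a.tri → ∀ hD : T.IsInternal D, ∀ h : T.IsInternal a.tri,
      χ.map A ⟨D, hD⟩ = χ ⟨a.tri, h⟩ + A.rot a.tri := by
    rintro D rfl hD h
    exact AdmissibleCut.map_apply A χ h hD
  constructor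
  · rintro ⟨hD, h⟩
    have hint : T.IsInternal a.tri := A.isInternal_iff.1 (htri ▸ hD)
    refine ⟨hint, ?_⟩
    rw [key _ htri hD hint, hcorner] at h
    exact add_right_cancel h
  · rintro ⟨hint, h⟩
    have hD : T.IsInternal (φ.arrow a).tri := by rw [htri]; exact A.isInternal hint
    exact ⟨hD, by rw [key _ htri hD hint, hcorner, h]⟩

/-! ### Equi-distribution -/

/-- The marked point at which a side of a triangle starts. -/
noncomputable def startPoint (s : T.Tri × Fin 3) : S := T.chart s.1 (cornerPoint s.2)

/-- The side of a triangle which follows a given one. -/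
def nextSide : Equiv.Perm (T.Tri × Fin 3) := (Equiv.refl _).prodCongr (Equiv.addRight 1)

/-- A side ends where the opposite side of its arc starts, since the two are glued with reversed
direction. -/
theorem startPoint_nextSide_arcSide (x : T.Arc ⊕ T.Arc) :
    startPoint (nextSide (T.arcSide x)) = startPoint (T.arcSide x.swap) := by
  have h := T.chart_sidePoint_swap x 1
  rw [sidePoint_one, unitInterval.symm_one, sidePoint_zero] at h
  exact h.symm

/-- A boundary side is a connected subset of the boundary containing both its endpoints. -/
theorem startPoint_nextSide_mem_iff {s : T.Tri × Fin 3} (hs : s ∉ Set.range T.arcSide) (x : S) :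
    startPoint (nextSide s) ∈ connectedComponentIn X.bdry x ↔
      startPoint s ∈ connectedComponentIn X.bdry x := by
  have hb := T.boundary_side s (by
    rintro ⟨i, hi⟩
    obtain ⟨y, hy, -⟩ := isSide_iff.1 hi
    exact hs ⟨y, hy⟩)
  have hc : Continuous fun t => T.chart s.1 (sidePoint s.2 t) := by
    refine (T.continuous_chart s.1).comp ?_
    unfold sidePoint
    fun_prop
  have hpre := isPreconnected_range hc
  have hsub : Set.range (fun t => T.chart s.1 (sidePoint s.2 t)) ⊆ X.bdry := by
    rintro _ ⟨t, rfl⟩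
    exact hb t
  have h0 : startPoint s ∈ Set.range fun t => T.chart s.1 (sidePoint s.2 t) :=
    ⟨0, by beta_reduce; rw [sidePoint_zero]; rfl⟩
  have h1 : startPoint (nextSide s) ∈ Set.range fun t => T.chart s.1 (sidePoint s.2 t) :=
    ⟨1, by beta_reduce; rw [sidePoint_one]; rfl⟩
  constructor <;> intro h <;> rw [connectedComponentIn_eq h]
  · exact hpre.subset_connectedComponentIn h1 hsub h0
  · exact hpre.subset_connectedComponentIn h0 hsub h1

open Classical in
/-- The indicator function of the corners selected by a cut. -/
noncomputable def AdmissibleCut.indicator (χ : T.AdmissibleCut) (s : T.Tri × Fin 3) : ℤ :=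
  if ∃ h : T.IsInternal s.1, χ ⟨s.1, h⟩ = s.2 then 1 else 0

theorem AdmissibleCut.indicator_eq_weight (χ : T.AdmissibleCut) (a : T.Arrow) :
    χ.indicator (a.tri, a.corner) = χ.weight a := by
  by_cases h : a ∈ χ.arrows
  · exact (if_pos h).trans (if_pos h).symm
  · exact (if_neg h).trans (if_neg h).symm

theorem AdmissibleCut.indicator_eq_zero (χ : T.AdmissibleCut) {s : T.Tri × Fin 3}
    (h : ¬ T.IsInternal s.1) : χ.indicator s = 0 :=
  if_neg fun ⟨h', _⟩ => h h'

-- Each internal triangle has exactly one selected corner, so triangles cut on `C` correspond to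
-- selected corners on `C`.
open Classical in
theorem AdmissibleCut.ncard_point_mem (χ : T.AdmissibleCut) (C : Set S) :
    ({D | χ.point D ∈ C}.ncard : ℤ) =
      ∑ s, (if startPoint s ∈ C then 1 else 0) * χ.indicator s := by
  have hinj : Function.Injective fun D : {D : T.Tri // T.IsInternal D} => (D.1, χ D) :=
    fun D D' h => Subtype.ext (congrArg Prod.fst h)
  rw [← Set.ncard_image_of_injective _ hinj, Set.ncard_eq_toFinset_card']
  simp only [AdmissibleCut.indicator, ite_zero_mul_ite_zero, mul_one]
  rw [Finset.sum_boole]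
  congr 2
  ext ⟨D, c⟩
  simp only [Set.mem_toFinset, Set.mem_image, Set.mem_ofPred_eq, Finset.mem_filter, Finset.mem_univ,
    true_and]
  constructor
  · rintro ⟨⟨D', h⟩, hp, he⟩
    obtain ⟨rfl, rfl⟩ := Prod.mk.inj he
    exact ⟨hp, h, rfl⟩
  · rintro ⟨hp, h, hc⟩
    have he : (D, χ ⟨D, h⟩) = (D, c) := Prod.ext rfl hc
    rw [← he] at hp
    exact ⟨⟨D, h⟩, hp, he⟩

open Classical in
/-- Cuts whose weights differ by a coboundary on the quiver are equi-distributed. -/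
theorem equiDistributed_of_weight {χ χ' : T.AdmissibleCut} (r : T.Arc → ℤ)
    (h : ∀ a : T.Arrow, χ'.weight a = χ.weight a + (r a.source - r a.target)) :
    EquiDistributed χ χ' := by
  -- All weights in a non-internal triangle are `0`, so `r` agrees on its arc sides.
  have hconst : ∀ x y, (T.arcSide x).1 = (T.arcSide y).1 → ¬ T.IsInternal (T.arcSide x).1 →
      r (arcOf x) = r (arcOf y) := by
    have hf : ∀ x y, Follows x y → ¬ T.IsInternal (T.arcSide x).1 →
        r (arcOf x) = r (arcOf y) := by
      intro x y hxy hD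
      obtain ⟨a, rfl, rfl⟩ := exists_of_follows hxy
      rw [arcSide_sourceSide] at hD
      have := h a
      rw [← AdmissibleCut.indicator_eq_weight, ← AdmissibleCut.indicator_eq_weight,
        AdmissibleCut.indicator_eq_zero (s := (a.tri, a.corner)) _ hD,
        AdmissibleCut.indicator_eq_zero (s := (a.tri, a.corner)) _ hD] at this
      rw [arcOf_sourceSide, arcOf_targetSide]
      linarith
    intro x y ht hD
    by_cases hxy : x = y
    · rw [hxy]
    rcases follows_or_follows hxy ht with h' | h'
    · exact hf _ _ h' hD
    · exact (hf _ _ h' (ht ▸ hD)).symm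
  -- The potential is extended to boundary sides by its value on any arc side of the same triangle,
  -- or by `0` if there is none. The coboundary identity then holds at all corners, not only at
  -- arrows.
  let p : T.Tri × Fin 3 → ℤ := fun s =>
    if h : ∃ x, T.arcSide x = s then r (arcOf h.choose)
    else if h : ∃ x, (T.arcSide x).1 = s.1 then r (arcOf h.choose) else 0
  have hp : ∀ x, p (T.arcSide x) = r (arcOf x) := by
    intro x
    have h : ∃ y, T.arcSide y = T.arcSide x := ⟨x, rfl⟩
    simp only [p, dif_pos h]
    rw [arcSide_injective h.choose_spec]
  have hp' : ∀ s x, ¬ T.IsInternal s.1 → (T.arcSide x).1 = s.1 → p s = r (arcOf x) := by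
    intro s x hs hx
    by_cases h1 : ∃ y, T.arcSide y = s
    · obtain ⟨y, rfl⟩ := h1
      rw [hp]
      exact hconst y x hx.symm hs
    · have h2 : ∃ x, (T.arcSide x).1 = s.1 := ⟨x, hx⟩
      simp only [p, dif_neg h1, dif_pos h2]
      exact hconst _ _ (h2.choose_spec.trans hx.symm) (by rw [h2.choose_spec]; exact hs)
  have hdiff : ∀ s, χ'.indicator (nextSide s) =
      χ.indicator (nextSide s) + (p s - p (nextSide s)) := by
    rintro ⟨D, c⟩
    by_cases hD : T.IsInternal D
    · obtain ⟨i, hi⟩ := hD c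
      obtain ⟨x, hx, -⟩ := isSide_iff.1 hi
      obtain ⟨j, hj⟩ := hD (c + 1)
      obtain ⟨y, hy, -⟩ := isSide_iff.1 hj
      obtain ⟨a, rfl, rfl⟩ := exists_of_follows (x := x) (y := y)
        (show T.arcSide y = _ by rw [hx, hy])
      change χ'.indicator (D, c + 1) = χ.indicator (D, c + 1) + (p (D, c) - p (D, c + 1))
      rw [← hx, ← hy, hp, hp, arcOf_sourceSide, arcOf_targetSide, arcSide_targetSide,
        AdmissibleCut.indicator_eq_weight, AdmissibleCut.indicator_eq_weight]
      exact h a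
    · rw [AdmissibleCut.indicator_eq_zero _ hD, AdmissibleCut.indicator_eq_zero _ hD, zero_add,
        eq_comm, sub_eq_zero]
      by_cases hx : ∃ x, (T.arcSide x).1 = D
      · obtain ⟨x, hx⟩ := hx
        rw [hp' (D, c) x hD hx, hp' (nextSide (D, c)) x hD hx]
      · have h0 : ∀ c, p (D, c) = 0 := fun c => by
          have h1 : ¬ ∃ x, T.arcSide x = (D, c) := fun ⟨x, h⟩ => hx ⟨x, congrArg Prod.fst h⟩
          simp only [p, dif_neg h1, dif_neg hx]
        exact (h0 c).trans (h0 (c + 1)).symm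
  intro z _
  set C := connectedComponentIn X.bdry z
  let e : T.Tri × Fin 3 → ℤ := fun s => if startPoint s ∈ C then 1 else 0
  -- Summation by parts along the cyclic order moves the difference onto `e`. It vanishes on
  -- boundary sides and is opposite on the two sides of an arc, where `p` has the same value.
  have hsum : ∑ s, e (nextSide s) * (p s - p (nextSide s)) = 0 := by
    have h1 : ∑ s, e (nextSide s) * (p s - p (nextSide s)) = ∑ s, (e (nextSide s) - e s) * p s := by
      simp only [mul_sub, sub_mul, Finset.sum_sub_distrib]
      rw [Equiv.sum_comp nextSide fun s => e s * p s]
    have h2 : ∑ x, (e (nextSide (T.arcSide x)) - e (T.arcSide x)) * r (arcOf x) =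
        ∑ s, (e (nextSide s) - e s) * p s := by
      refine Fintype.sum_of_injective T.arcSide arcSide_injective _ _ (fun s hs => ?_) fun x => ?_
      · simp only [e, C, startPoint_nextSide_mem_iff hs, sub_self, zero_mul]
      · rw [hp]
    rw [h1, ← h2, Fintype.sum_sum_type, ← Finset.sum_add_distrib]
    refine Finset.sum_eq_zero fun i _ => ?_
    simp only [e, startPoint_nextSide_arcSide, Sum.swap_inl, Sum.swap_inr]
    simp only [arcOf, Sum.elim_inl, Sum.elim_inr, id]
    ring
  have hcount : (∑ s, e s * χ'.indicator s) = ∑ s, e s * χ.indicator s := by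
    rw [← Equiv.sum_comp nextSide fun s => e s * χ'.indicator s,
      ← Equiv.sum_comp nextSide fun s => e s * χ.indicator s]
    simp only [hdiff, mul_add, Finset.sum_add_distrib]
    rw [hsum, add_zero]
  have h1 := χ.ncard_point_mem C
  have h2 := χ'.ncard_point_mem C
  exact_mod_cast h1.trans (hcount.symm.trans h2.symm)

end Triangulation

/-! ### The mapping class and the comparison of cuts -/

open Triangulation in
theorem theorem4p3 {k : Type*} [Field k]
    {S : Type*} [TopologicalSpace S] [T2Space S] [CompactSpace S] [ConnectedSpace S]
    [ChartedSpace (EuclideanHalfSpace 2) S] (X : MarkedSurface S) (T : Triangulation X)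
    (χ₁ χ₂ : T.AdmissibleCut) (E : Triangulation.GradedEquivalence k χ₁ χ₂)
    (φ : T.QuiverAut) (hφ : Triangulation.AlgHomInduces E.map φ) :
    ∃ F : X.MappingClassGroup, T.MappingClassInduces F φ ∧
      ∃ χ₁' : T.AdmissibleCut, Triangulation.AdmissibleCut.IsImage φ χ₁ χ₁' ∧
        Triangulation.EquiDistributed χ₁' χ₂ := by
  obtain ⟨A, hA, hArrow⟩ := hφ.preservesRelations.exists_automorphism
  have hmem := AdmissibleCut.mem_arrows_map hArrow χ₁
  -- The shifts belong to the source quiver, so the potential for the image cut is `r` transported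
  -- along `φ`.
  refine ⟨QuotientGroup.mk ⟨realize A, realize_mem_homeoPlus A⟩, ⟨_, rfl, fun i => ?_, fun a => ?_⟩,
    χ₁.map A, ?_, equiDistributed_of_weight (fun i => E.r (φ.vertex.symm i)) fun b => ?_⟩
  · rw [← hA]
    exact realize_image_arcSet A i
  · rw [(hArrow a).1]
    exact realize_image_triSet A a.tri
  · ext b
    obtain ⟨a, rfl⟩ := φ.arrow.surjective b
    rw [hmem, φ.arrow.injective.mem_set_image]
  · obtain ⟨a, rfl⟩ := φ.arrow.surjective b
    rw [E.weight_arrow hφ, φ.source_arrow, φ.target_arrow, Equiv.symm_apply_apply,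
      Equiv.symm_apply_apply]
    congr 1
    by_cases ha : a ∈ χ₁.arrows
    · exact (if_pos ha).trans (if_pos ((hmem a).2 ha)).symm
    · exact (if_neg ha).trans (if_neg fun h => ha ((hmem a).1 h)).symm
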